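/- For a real number $\alpha>-1$ let $L$ be the three-dimensional Lamé operator $Lu=-\Delta u-\alpha\,\mathrm{grad}\,\mathrm{div}\,u$ acting on vector fields $u=(u_1,u_2,u_3)^T$ on $\mathbb R^3$, and let $\Phi=(\Phi_{ij})_{i,j=1}^3$ be its fundamental matrix $$\Phi_{ij}(x)=\frac{\alpha+2}{8\pi(\alpha+1)}\,\frac1{|x|}\Bigl(\delta_{ij}+\frac{\alpha}{\alpha+2}\,\frac{x_ix_j}{|x|^2}\Bigr).$$ We say that $L$ is positive definite with weight $\Phi$ if $\int_{\mathbb R^3}(Lu)^T\Phi u\,dx\ge 0$ for all real vector fields $u$ with components in $C_0^\infty(\mathbb R^3\setminus\{0\})$. Let $\alpha_-$ be the smallest zero in $(-1,\infty)$ of $$p_-(\alpha)=\frac{1}{6(\alpha+2)^2}\Bigl[-(2+7\sqrt3)\alpha^4+2(15+\sqrt2-11\sqrt3+\sqrt6)\alpha^3+2(57+3\sqrt2-10\sqrt3+3\sqrt6)\alpha^2+6(20+\sqrt2+\sqrt6)\alpha+24\Bigr],$$ let $\alpha_+$ be the largest zero in $(-1,\infty)$ of $$p_+(\alpha)=-\frac{\alpha}{12(\alpha+2)^3}\Bigl[6\alpha^5+(23+3\sqrt2)\alpha^4+(13+19\sqrt2)\alpha^3-(77-38\sqrt2)\alpha^2-(157-24\sqrt2)\alpha-96\Bigr],$$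 and let $\alpha_-^{(c)}$ and $\alpha_+^{(c)}$ be the smallest and the largest real zero of $q(\alpha)=(\alpha+1)(3\alpha+4)^2-\alpha^4/4$. **Theorem.** These zeros exist, and $|\alpha_-+0.194|<10^{-3}$, $|\alpha_+-1.524|<5\cdot10^{-4}$, $|\alpha_-^{(c)}+0.902|<5\cdot10^{-4}$, $|\alpha_+^{(c)}-39.450|<5\cdot10^{-4}$. Moreover: 1. If $\alpha_-<\alpha<\alpha_+$, then $L$ is positive definite with weight $\Phi$. 2. If $\alpha_-<\alpha<\alpha_+$, then there is a constant $c>0$ depending only on $\alpha$ such that, for all real vector fields $u$ with components in $C_0^\infty(\mathbb R^3)$, the functions $(Lu)^T\Phi u$ and $|Du|^2/|x|$ are integrable on $\mathbb R^3$ and $$\int_{\mathbb R^3}(Lu)^T\Phi u\,dx\ \ge\ \tfrac12|u(0)|^2+c\int_{\mathbb R^3}\frac{|Du(x)|^2}{|x|}\,dx,$$ where $|Du|^2=\sum_{i,k}(\partial_k u_i)^2$. 3. If $-1<\alpha<\alpha_-^{(c)}$ or $\alpha>\alpha_+^{(c)}$, then $L$ is not positive definite with weight $\Phi$. -/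

import Mathlib

open MeasureTheory
open scoped ContDiff

noncomputable section

/-- Three-dimensional Euclidean space. -/
abbrev E3 : Type := EuclideanSpace ℝ (Fin 3)

/-- The classical partial derivative `D_k f` of a scalar function. -/
def partialD (k : Fin 3) (f : E3 → ℝ) (x : E3) : ℝ :=
  fderiv ℝ f x (EuclideanSpace.single k 1)

/-- The divergence `D_k u_k` of a vector field. -/
def divergence (u : E3 → E3) (x : E3) : ℝ :=
  ∑ k : Fin 3, partialD k (fun y => u y k) x

/-- The `i`-th component of the Lamé operator, `(L u)_i = - D_kk u_i - α D_i (div u)`. -/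
def lame (α : ℝ) (u : E3 → E3) (i : Fin 3) (x : E3) : ℝ :=
  -(∑ k : Fin 3, partialD k (partialD k (fun y => u y i)) x)
    - α * partialD i (divergence u) x

/-- The pointwise expression `(L u)ᵀ Ψ u`. -/
def lameIntegrand (α : ℝ) (Ψ : E3 → Matrix (Fin 3) (Fin 3) ℝ) (u : E3 → E3) (x : E3) : ℝ :=
  ∑ i : Fin 3, ∑ j : Fin 3, lame α u i x * Ψ x i j * u x j

/-- `L` is positive definite with weight `Ψ`: `∫ (L u)ᵀ Ψ u dx ≥ 0` for all real vector fields
`u` that are smooth with compact support contained in `ℝ³ ∖ {0}`. -/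
def PosDefWithWeight (α : ℝ) (Ψ : E3 → Matrix (Fin 3) (Fin 3) ℝ) : Prop :=
  ∀ u : E3 → E3, ContDiff ℝ ∞ u → HasCompactSupport u → tsupport u ⊆ {(0 : E3)}ᶜ →
    0 ≤ ∫ x : E3, lameIntegrand α Ψ u x

/-- The constant `c_α = (α + 2) / (8 π (α + 1))`. -/
def lameConst (α : ℝ) : ℝ := (α + 2) / (8 * Real.pi * (α + 1))

/-- The fundamental matrix of the Lamé operator,
`Φ_ij = c_α r⁻¹ (δ_ij + α / (α + 2) ω_i ω_j)` with `r = |x|` and `ω = x / |x|`. -/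
def fundMatrix (α : ℝ) (x : E3) : Matrix (Fin 3) (Fin 3) ℝ :=
  fun i j => lameConst α * ‖x‖⁻¹ *
    ((if i = j then 1 else 0) + α / (α + 2) * (x i / ‖x‖) * (x j / ‖x‖))

/-- `|Du|²`, the sum of the squares of the entries of the Jacobian matrix. -/
def gradNormSq (u : E3 → E3) (x : E3) : ℝ :=
  ∑ i : Fin 3, ∑ k : Fin 3, (partialD k (fun y => u y i) x) ^ 2

/-- The function whose largest zero is `α₊`. -/
def pPlus (α : ℝ) : ℝ :=
  -(α / (12 * (α + 2) ^ 3)) *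
    (6 * α ^ 5 + (23 + 3 * √2) * α ^ 4 + (13 + 19 * √2) * α ^ 3
      - (77 - 38 * √2) * α ^ 2 - (157 - 24 * √2) * α - 96)

/-- The function whose smallest zero is `α₋`. -/
def pMinus (α : ℝ) : ℝ :=
  1 / (6 * (α + 2) ^ 2) *
    (-(2 + 7 * √3) * α ^ 4 + 2 * (15 + √2 - 11 * √3 + √6) * α ^ 3
      + 2 * (57 + 3 * √2 - 10 * √3 + 3 * √6) * α ^ 2 + 6 * (20 + √2 + √6) * α + 24)

/-- The polynomial whose smallest and largest real zeros are the critical values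
`α₋⁽ᶜ⁾` and `α₊⁽ᶜ⁾`. -/
def qCrit (α : ℝ) : ℝ := (α + 1) * (3 * α + 4) ^ 2 - α ^ 4 / 4

end

/-! Up to the factor `lameConst α`, the weight is the kernel |x|⁻¹(δ_ij + β ω_i ω_j) with β =
α/(α+2). Integration by parts is legitimate across the origin because all singularities are at most
|x|⁻², and it turns ∫(Lu)ᵀΦu into a quadratic form in Du (`gradientForm`) plus terms containing u,
Du and one derivative of the kernel. Since α(β−1) = −2β, these extra terms split exactly into radial
derivatives of the products u_i u_j and a multiple of `rotationForm`, which is built from the fields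
x_i D_j − x_j D_i. The radial derivatives integrate along rays to a point evaluation, which becomes
|u(0)|²/2 after normalisation. Rotation fields integrate to zero against radial weights, so the
undifferentiated u in `rotationForm` may be replaced by its deviation from a radial mean. This is
`hasIntegralEq_energy`.

The mean is taken over the equator of each sphere. A Poincaré inequality for it
(`integral_poincare`) then follows from Wirtinger's inequality on circles and a one-dimensional
inequality along meridians, with the crude constant 2. The rotation term thus costs at most 2|β|
times the tangential energy. For −0.195 < α < 1.5245, `gradientForm_coercive` pays this cost and
keeps |Du|²/(10|x|). That interval contains (α₋, α₊), and `pMinus` and `pPlus` enter only through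
the location of their zeros.

For the negative part, the fields χ cos(Nξ·x) a and χ sin(Nξ·x) a give two integrals whose sum is
exactly N²∫χ² σ + K, where σ is the principal symbol `lameSymbol` and K does not depend on N. If σ
is negative at one point, a bump χ near it and a large N violate positivity. A suitable ξ and a make
σ negative whenever `qCrit α` is. -/

/-! ### Location of the four critical values -/

theorem exists_isLeast_of_sign_change {f : ℝ → ℝ} {S : Set ℝ} {a b : ℝ} (hab : a ≤ b)
    (hf : ContinuousOn f (Set.Icc a b)) (h0 : (0 : ℝ) ∈ Set.uIcc (f a) (f b))
    (hS : ∀ t ∈ Set.Icc a b, t ∈ S ↔ f t = 0) (hlow : ∀ t ∈ S, a ≤ t) :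
    ∃ z ∈ Set.Icc a b, IsLeast S z := by
  -- The zeros in [a, b] form a nonempty compact set, so a least one exists; `hlow` rules out
  -- smaller elements of `S`, and those beyond b are irrelevant.
  have hne : (Set.Icc a b ∩ f ⁻¹' {0}).Nonempty := by
    have := intermediate_value_uIcc (f := f) (a := a) (b := b) (by rwa [Set.uIcc_of_le hab])
    obtain ⟨t, ht, h⟩ := this h0
    rw [Set.uIcc_of_le hab] at ht
    exact ⟨t, ht, h⟩
  have hcomp : IsCompact (Set.Icc a b ∩ f ⁻¹' {0}) :=
    isCompact_Icc.of_isClosed_subset (hf.preimage_isClosed_of_isClosed isClosed_Icc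
      isClosed_singleton) Set.inter_subset_left
  obtain ⟨z, ⟨hz, hfz⟩, hmin⟩ := hcomp.exists_isLeast hne
  refine ⟨z, hz, (hS z hz).2 hfz, fun t ht => ?_⟩
  by_cases htb : t ≤ b
  · have hI : t ∈ Set.Icc a b := ⟨hlow t ht, htb⟩
    exact hmin ⟨hI, (hS t hI).1 ht⟩
  · exact hz.2.trans (not_le.1 htb).le

theorem exists_isGreatest_of_sign_change {f : ℝ → ℝ} {S : Set ℝ} {a b : ℝ} (hab : a ≤ b)
    (hf : ContinuousOn f (Set.Icc a b)) (h0 : (0 : ℝ) ∈ Set.uIcc (f a) (f b))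
    (hS : ∀ t ∈ Set.Icc a b, t ∈ S ↔ f t = 0) (hup : ∀ t ∈ S, t ≤ b) :
    ∃ z ∈ Set.Icc a b, IsGreatest S z := by
  have hne : (Set.Icc a b ∩ f ⁻¹' {0}).Nonempty := by
    have := intermediate_value_uIcc (f := f) (a := a) (b := b) (by rwa [Set.uIcc_of_le hab])
    obtain ⟨t, ht, h⟩ := this h0
    rw [Set.uIcc_of_le hab] at ht
    exact ⟨t, ht, h⟩
  have hcomp : IsCompact (Set.Icc a b ∩ f ⁻¹' {0}) :=
    isCompact_Icc.of_isClosed_subset (hf.preimage_isClosed_of_isClosed isClosed_Icc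
      isClosed_singleton) Set.inter_subset_left
  obtain ⟨z, ⟨hz, hfz⟩, hmax⟩ := hcomp.exists_isGreatest hne
  refine ⟨z, hz, (hS z hz).2 hfz, fun t ht => ?_⟩
  by_cases hta : a ≤ t
  · have hI : t ∈ Set.Icc a b := ⟨hta, hup t ht⟩
    exact hmax ⟨hI, (hS t hI).1 ht⟩
  · exact (not_le.1 hta).le.trans hz.1

theorem sqrt_two_bounds : 1.41421 < √2 ∧ √2 < 1.41422 :=
  ⟨Real.lt_sqrt_of_sq_lt (by norm_num), (Real.sqrt_lt' (by norm_num)).2 (by norm_num)⟩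

theorem sqrt_three_bounds : 1.73205 < √3 ∧ √3 < 1.73206 :=
  ⟨Real.lt_sqrt_of_sq_lt (by norm_num), (Real.sqrt_lt' (by norm_num)).2 (by norm_num)⟩

theorem sqrt_six_bounds : 2.44948 < √6 ∧ √6 < 2.4495 :=
  ⟨Real.lt_sqrt_of_sq_lt (by norm_num), (Real.sqrt_lt' (by norm_num)).2 (by norm_num)⟩

theorem pMinus_neg {t : ℝ} (h1 : -1 < t) (h2 : t ≤ -0.195) : pMinus t < 0 := by
  obtain ⟨a1, a2⟩ := sqrt_two_bounds
  obtain ⟨b1, b2⟩ := sqrt_three_bounds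
  obtain ⟨c1, c2⟩ := sqrt_six_bounds
  unfold pMinus
  refine mul_neg_of_pos_of_neg (by have : 0 < t + 2 := by linarith
                                   positivity) ?_
  -- Grouped by radicals: on this range the factor of √3 is nonnegative and that of √2 + √6 is
  -- nonpositive, so lower rational bounds for the roots suffice.
  have e : -(2 + 7 * √3) * t ^ 4 + 2 * (15 + √2 - 11 * √3 + √6) * t ^ 3
      + 2 * (57 + 3 * √2 - 10 * √3 + 3 * √6) * t ^ 2 + 6 * (20 + √2 + √6) * t + 24
      = (-2 * t ^ 4 + 30 * t ^ 3 + 114 * t ^ 2 + 120 * t + 24)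
        - √3 * (t ^ 2 * (7 * t ^ 2 + 22 * t + 20)) + (√2 + √6) * (2 * t * (t ^ 2 + 3 * t + 3)) := by
    ring
  have hA : 0 ≤ t ^ 2 * (7 * t ^ 2 + 22 * t + 20) := by
    have : 0 ≤ 7 * t ^ 2 + 22 * t + 20 := by nlinarith [sq_nonneg (t + 1)]
    positivity
  have hB : 2 * t * (t ^ 2 + 3 * t + 3) ≤ 0 := by
    have : 0 ≤ t ^ 2 + 3 * t + 3 := by nlinarith [sq_nonneg (t + 1)]
    nlinarith
  rw [e]
  have h3 : 1.73205 * (t ^ 2 * (7 * t ^ 2 + 22 * t + 20))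
      ≤ √3 * (t ^ 2 * (7 * t ^ 2 + 22 * t + 20)) := by gcongr
  have h4 : (√2 + √6) * (2 * t * (t ^ 2 + 3 * t + 3))
      ≤ (1.41421 + 2.44948) * (2 * t * (t ^ 2 + 3 * t + 3)) :=
    mul_le_mul_of_nonpos_right (by linarith) hB
  have h5 : (-2 * t ^ 4 + 30 * t ^ 3 + 114 * t ^ 2 + 120 * t + 24)
      - 1.73205 * (t ^ 2 * (7 * t ^ 2 + 22 * t + 20))
      + (1.41421 + 2.44948) * (2 * t * (t ^ 2 + 3 * t + 3)) < 0 := by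
    have hp : 0 ≤ (t + 1) * (-0.195 - t) := mul_nonneg (by linarith) (by linarith)
    nlinarith [mul_nonneg hp (sq_nonneg t), mul_nonneg hp (by linarith : 0 ≤ -t), hp,
      mul_nonneg hp (by linarith : 0 ≤ t + 1)]
  linarith

theorem pMinus_pos_right : 0 < pMinus (-0.193) := by
  obtain ⟨a1, a2⟩ := sqrt_two_bounds
  obtain ⟨b1, b2⟩ := sqrt_three_bounds
  obtain ⟨c1, c2⟩ := sqrt_six_bounds
  unfold pMinus
  refine mul_pos (by norm_num) ?_
  norm_num
  nlinarith

theorem exists_isLeast_pMinus :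
    ∃ a ∈ Set.Icc (-0.195 : ℝ) (-0.193), IsLeast {t : ℝ | -1 < t ∧ pMinus t = 0} a ∧ a ≠ -0.195
      ∧ a ≠ -0.193 := by
  have hc : ContinuousOn pMinus (Set.Icc (-0.195 : ℝ) (-0.193)) := by
    unfold pMinus
    refine ContinuousOn.mul (ContinuousOn.div continuousOn_const (by fun_prop) ?_) (by fun_prop)
    intro x hx
    have : 0 < x + 2 := by linarith [hx.1]
    positivity
  obtain ⟨z, hz, hl⟩ := exists_isLeast_of_sign_change (S := {t : ℝ | -1 < t ∧ pMinus t = 0})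
    (by norm_num) hc
    (Set.Icc_subset_uIcc ⟨(pMinus_neg (by norm_num) le_rfl).le, pMinus_pos_right.le⟩)
    (fun t ht => ⟨fun h => h.2, fun h => ⟨by linarith [ht.1], h⟩⟩)
    (fun t ht => by
      by_contra! h
      exact (pMinus_neg ht.1 h.le).ne ht.2)
  -- The endpoints are not zeros, which makes the final error bound strict.
  refine ⟨z, hz, hl, fun h => ?_, fun h => ?_⟩
  · exact (pMinus_neg (by norm_num) le_rfl).ne (h ▸ hl.1.2)
  · exact pMinus_pos_right.ne' (h ▸ hl.1.2)

theorem pPlus_neg {t : ℝ} (h : 1.5245 ≤ t) : pPlus t < 0 := by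
  obtain ⟨a1, a2⟩ := sqrt_two_bounds
  unfold pPlus
  have ht : 0 < t := by linarith
  have e : 6 * t ^ 5 + (23 + 3 * √2) * t ^ 4 + (13 + 19 * √2) * t ^ 3
      - (77 - 38 * √2) * t ^ 2 - (157 - 24 * √2) * t - 96
      = (6 * t ^ 5 + 23 * t ^ 4 + 13 * t ^ 3 - 77 * t ^ 2 - 157 * t - 96)
        + √2 * (3 * t ^ 4 + 19 * t ^ 3 + 38 * t ^ 2 + 24 * t) := by ring
  rw [e]
  have h1 : 1.41421 * (3 * t ^ 4 + 19 * t ^ 3 + 38 * t ^ 2 + 24 * t)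
      ≤ √2 * (3 * t ^ 4 + 19 * t ^ 3 + 38 * t ^ 2 + 24 * t) := by gcongr
  have h2 : 0 < (6 * t ^ 5 + 23 * t ^ 4 + 13 * t ^ 3 - 77 * t ^ 2 - 157 * t - 96)
      + 1.41421 * (3 * t ^ 4 + 19 * t ^ 3 + 38 * t ^ 2 + 24 * t) := by
    -- Expanded around 1.5245, the polynomial has only positive coefficients.
    obtain ⟨s, hs, rfl⟩ : ∃ s, 0 ≤ s ∧ t = 1.5245 + s := ⟨t - 1.5245, by linarith, by ring⟩
    ring_nf
    positivity
  exact mul_neg_of_neg_of_pos (by rw [neg_lt_zero]; positivity) (by linarith)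

theorem pPlus_pos_left : 0 < pPlus 1.5235 := by
  obtain ⟨a1, a2⟩ := sqrt_two_bounds
  unfold pPlus
  refine mul_pos_of_neg_of_neg (by norm_num) ?_
  norm_num
  nlinarith

theorem exists_isGreatest_pPlus :
    ∃ a ∈ Set.Icc (1.5235 : ℝ) 1.5245, IsGreatest {t : ℝ | -1 < t ∧ pPlus t = 0} a ∧ a ≠ 1.5235
      ∧ a ≠ 1.5245 := by
  have hc : ContinuousOn pPlus (Set.Icc (1.5235 : ℝ) 1.5245) := by
    unfold pPlus
    refine ContinuousOn.mul (ContinuousOn.neg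
      (ContinuousOn.div continuousOn_id (by fun_prop) ?_)) (by fun_prop)
    intro x hx
    have : 0 < x + 2 := by linarith [hx.1]
    positivity
  obtain ⟨z, hz, hl⟩ := exists_isGreatest_of_sign_change (S := {t : ℝ | -1 < t ∧ pPlus t = 0})
    (by norm_num) hc
    (Set.Icc_subset_uIcc' ⟨(pPlus_neg le_rfl).le, pPlus_pos_left.le⟩)
    (fun t ht => ⟨fun h => h.2, fun h => ⟨by linarith [ht.1], h⟩⟩)
    (fun t ht => by
      by_contra! h
      exact (pPlus_neg h.le).ne ht.2)
  refine ⟨z, hz, hl, fun h => ?_, fun h => ?_⟩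
  · exact pPlus_pos_left.ne' (h ▸ hl.1.2)
  · exact (pPlus_neg le_rfl).ne (h ▸ hl.1.2)

theorem continuous_qCrit : Continuous qCrit := by
  unfold qCrit
  fun_prop

theorem qCrit_neg_of_le {t : ℝ} (h : t ≤ -0.9025) : qCrit t < 0 := by
  unfold qCrit
  obtain ⟨s, hs, rfl⟩ : ∃ s, 0 ≤ s ∧ t = -0.9025 - s := ⟨-0.9025 - t, by linarith, by ring⟩
  nlinarith [mul_nonneg hs (sq_nonneg (s - 0.4)), mul_nonneg hs (sq_nonneg s), pow_nonneg hs 4]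

theorem qCrit_neg_of_ge {t : ℝ} (h : 39.4505 ≤ t) : qCrit t < 0 := by
  unfold qCrit
  obtain ⟨s, hs, rfl⟩ : ∃ s, 0 ≤ s ∧ t = 39.4505 + s := ⟨t - 39.4505, by linarith, by ring⟩
  rw [← neg_pos]
  ring_nf
  positivity

theorem exists_isLeast_qCrit :
    ∃ a ∈ Set.Icc (-0.9025 : ℝ) (-0.9015), IsLeast {t : ℝ | qCrit t = 0} a ∧ a ≠ -0.9025
      ∧ a ≠ -0.9015 := by
  have hp : 0 < qCrit (-0.9015) := by unfold qCrit; norm_num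
  obtain ⟨z, hz, hl⟩ := exists_isLeast_of_sign_change (S := {t : ℝ | qCrit t = 0})
    (by norm_num) continuous_qCrit.continuousOn
    (Set.Icc_subset_uIcc ⟨(qCrit_neg_of_le le_rfl).le, hp.le⟩)
    (fun t ht => Iff.rfl)
    (fun t ht => by
      by_contra! h
      exact (qCrit_neg_of_le h.le).ne ht)
  refine ⟨z, hz, hl, fun h => ?_, fun h => ?_⟩
  · exact (qCrit_neg_of_le le_rfl).ne (h ▸ hl.1)
  · exact hp.ne' (h ▸ hl.1)

theorem exists_isGreatest_qCrit :
    ∃ a ∈ Set.Icc (39.4495 : ℝ) 39.4505, IsGreatest {t : ℝ | qCrit t = 0} a ∧ a ≠ 39.4495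
      ∧ a ≠ 39.4505 := by
  have hp : 0 < qCrit 39.4495 := by unfold qCrit; norm_num
  obtain ⟨z, hz, hl⟩ := exists_isGreatest_of_sign_change (S := {t : ℝ | qCrit t = 0})
    (by norm_num) continuous_qCrit.continuousOn
    (Set.Icc_subset_uIcc' ⟨(qCrit_neg_of_ge le_rfl).le, hp.le⟩)
    (fun t ht => Iff.rfl)
    (fun t ht => by
      by_contra! h
      exact (qCrit_neg_of_ge h.le).ne ht)
  refine ⟨z, hz, hl, fun h => ?_, fun h => ?_⟩
  · exact hp.ne' (h ▸ hl.1)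
  · exact (qCrit_neg_of_ge le_rfl).ne (h ▸ hl.1)

/-- `qCrit` is negative far to the left, so a nonnegative value at t would force a zero at or before
t, hence below the least one. -/
theorem qCrit_neg_of_lt_isLeast {a t : ℝ} (ha : IsLeast {t : ℝ | qCrit t = 0} a) (h : t < a) :
    qCrit t < 0 := by
  by_contra! h0
  rcases le_total t (-0.9025) with h1 | h1
  · exact (qCrit_neg_of_le h1).not_ge h0
  · obtain ⟨s, hs, hs0⟩ := intermediate_value_Icc h1 continuous_qCrit.continuousOn
      ⟨(qCrit_neg_of_le le_rfl).le, h0⟩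
    exact (ha.2 hs0).not_gt (hs.2.trans_lt h)

theorem qCrit_neg_of_isGreatest_lt {a t : ℝ} (ha : IsGreatest {t : ℝ | qCrit t = 0} a)
    (h : a < t) : qCrit t < 0 := by
  by_contra! h0
  rcases le_total 39.4505 t with h1 | h1
  · exact (qCrit_neg_of_ge h1).not_ge h0
  · obtain ⟨s, hs, hs0⟩ := intermediate_value_Icc' h1 continuous_qCrit.continuousOn
      ⟨(qCrit_neg_of_ge le_rfl).le, h0⟩
    exact (ha.2 hs0).not_gt (h.trans_le hs.1)

/-! ### Spherical coordinates -/

open Real in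
/-- The point of `ℝ³` with spherical coordinates `(r, θ, φ)`. -/
noncomputable def sphPoint (r θ φ : ℝ) : E3 :=
  !₂[r * (sin θ * cos φ), r * (sin θ * sin φ), r * cos θ]

/-- The measure `r² dr` on `(0, ∞)`. -/
noncomputable def radialMeasure : Measure ℝ :=
  (volume.restrict (Set.Ioi 0)).withDensity fun r => ENNReal.ofReal (r ^ 2)

/-- The measure `sin θ dθ` on `(0, π)`. -/
noncomputable def polarMeasure : Measure ℝ :=
  (volume.restrict (Set.Ioo 0 Real.pi)).withDensity fun θ => ENNReal.ofReal (Real.sin θ)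

/-- The measure `dφ` on `(-π, π)`. -/
noncomputable def azimuthMeasure : Measure ℝ := volume.restrict (Set.Ioo (-Real.pi) Real.pi)

instance : SFinite radialMeasure := by unfold radialMeasure; infer_instance
instance : SFinite polarMeasure := by unfold polarMeasure; infer_instance
instance : SFinite azimuthMeasure := by unfold azimuthMeasure; infer_instance

theorem continuous_sphPoint {X : Type*} [TopologicalSpace X] {a b c : X → ℝ} (ha : Continuous a)
    (hb : Continuous b) (hc : Continuous c) : Continuous fun x => sphPoint (a x) (b x) (c x) := by
  unfold sphPoint
  refine (PiLp.continuous_toLp 2 _).comp (continuous_pi fun i => ?_)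
  fin_cases i <;> simp <;> fun_prop

theorem continuous_e3_mk {X : Type*} [TopologicalSpace X] {a b c : X → ℝ} (ha : Continuous a)
    (hb : Continuous b) (hc : Continuous c) :
    Continuous fun x => (!₂[a x, b x, c x] : E3) := by
  refine (PiLp.continuous_toLp 2 _).comp (continuous_pi fun i => ?_)
  fin_cases i <;> simpa

theorem lintegral_e3 (F : E3 → ENNReal) (hF : Measurable F) :
    ∫⁻ x, F x = ∫⁻ z : ℝ, ∫⁻ p : ℝ × ℝ, F !₂[p.1, p.2, z] := by
  have h1 : MeasurePreserving (fun q : ℝ × (ℝ × ℝ) => (!₂[q.2.1, q.2.2, q.1] : E3)) := by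
    have e1 := (volume_preserving_piFinSuccAbove (fun _ : Fin 3 => ℝ) 2).symm
    have e2 := (MeasurePreserving.id (volume : Measure ℝ)).prod
      (volume_preserving_finTwoArrow ℝ).symm
    have e3 := PiLp.volume_preserving_toLp (Fin 3)
    have := e3.comp (e1.comp e2)
    convert this using 1
    · ext q i
      fin_cases i <;> rfl
    · rfl
  rw [← h1.lintegral_comp hF]
  have hc : Continuous (fun q : ℝ × (ℝ × ℝ) => (!₂[q.2.1, q.2.2, q.1] : E3)) :=
    continuous_e3_mk (by fun_prop) (by fun_prop) (by fun_prop)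
  exact lintegral_prod _ (hF.comp hc.measurable).aemeasurable

/-- The weight vanishes for r ≤ 0. A polar integral over the half-line thus becomes one over the
whole line, ready for a second polar change of variables. -/
theorem setLIntegral_Ioi_ofReal_mul (G : ℝ → ENNReal) :
    ∫⁻ r in Set.Ioi 0, ENNReal.ofReal r * G r = ∫⁻ r, ENNReal.ofReal r * G r := by
  rw [← lintegral_indicator measurableSet_Ioi]
  congr 1
  ext r
  by_cases h : 0 < r
  · simp [h]
  · simp [h, ENNReal.ofReal_of_nonpos (not_lt.1 h)]

/-- Polar coordinates are used twice: in the horizontal plane, giving (ρ, φ), and then in the (z, ρ)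
plane, with z = r cos θ and ρ = r sin θ. The two Jacobians multiply to ρ r = r² sin θ. -/
theorem lintegral_spherical (F : E3 → ENNReal) (hF : Measurable F) :
    ∫⁻ x, F x = ∫⁻ φ in Set.Ioo (-Real.pi) Real.pi, ∫⁻ r in Set.Ioi 0,
      ∫⁻ θ in Set.Ioo 0 Real.pi, ENNReal.ofReal (r ^ 2) *
        (ENNReal.ofReal (Real.sin θ) * F (sphPoint r θ φ)) := by
  have hm : ∀ {X : Type} [TopologicalSpace X] [MeasurableSpace X] [BorelSpace X] {a b c : X → ℝ},
      Continuous a → Continuous b → Continuous c →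
      Measurable fun x => F !₂[a x, b x, c x] := fun ha hb hc =>
    hF.comp (continuous_e3_mk ha hb hc).measurable
  rw [lintegral_e3 F hF]
  have s1 : ∀ z : ℝ, ∫⁻ p : ℝ × ℝ, F !₂[p.1, p.2, z]
      = ∫⁻ φ in Set.Ioo (-Real.pi) Real.pi, ∫⁻ ρ : ℝ,
        ENNReal.ofReal ρ * F !₂[ρ * Real.cos φ, ρ * Real.sin φ, z] := by
    intro z
    rw [← lintegral_comp_polarCoord_symm (fun p : ℝ × ℝ => F !₂[p.1, p.2, z]),
      polarCoord_target, Measure.volume_eq_prod, ← Measure.prod_restrict, lintegral_prod_symm]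
    · refine lintegral_congr fun φ => ?_
      rw [← setLIntegral_Ioi_ofReal_mul]
      simp [polarCoord_symm_apply]
    · refine Measurable.aemeasurable ?_
      simp only [polarCoord_symm_apply, smul_eq_mul]
      exact (by fun_prop : Measurable fun a : ℝ × ℝ => ENNReal.ofReal a.1).mul
        (hm (by fun_prop) (by fun_prop) (by fun_prop))
  simp_rw [s1]
  rw [lintegral_lintegral_swap]
  · refine lintegral_congr fun φ => ?_
    rw [← lintegral_prod (fun p : ℝ × ℝ => ENNReal.ofReal p.2 *
      F !₂[p.2 * Real.cos φ, p.2 * Real.sin φ, p.1])]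
    · rw [← Measure.volume_eq_prod, ← lintegral_comp_polarCoord_symm, polarCoord_target,
        Measure.volume_eq_prod, ← Measure.prod_restrict, lintegral_prod]
      · refine setLIntegral_congr_fun measurableSet_Ioi fun r hr => ?_
        have hr : 0 < r := hr
        simp only [polarCoord_symm_apply, smul_eq_mul]
        -- Planar polar angles range over (−π, π); those with θ ≤ 0 drop out because `ENNReal.ofReal
        -- (r * sin θ)` is zero there.
        have hsub : Set.Ioo 0 Real.pi ⊆ Set.Ioo (-Real.pi) Real.pi :=
          Set.Ioo_subset_Ioo_left (by linarith [Real.pi_pos])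
        rw [← lintegral_indicator measurableSet_Ioo, ← lintegral_indicator measurableSet_Ioo]
        refine lintegral_congr fun θ => ?_
        by_cases h : θ ∈ Set.Ioo 0 Real.pi
        · rw [Set.indicator_of_mem (hsub h), Set.indicator_of_mem h]
          rw [← mul_assoc, ← mul_assoc, ← ENNReal.ofReal_mul hr.le,
            ← ENNReal.ofReal_mul (by positivity)]
          simp only [sphPoint]
          congr 2
          · ring
          · simp only [mul_assoc]
        · rw [Set.indicator_of_notMem h]
          by_cases h' : θ ∈ Set.Ioo (-Real.pi) Real.pi
          · rw [Set.indicator_of_mem h']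
            have h0 : θ ≤ 0 := by
              by_contra! hh
              exact h ⟨hh, h'.2⟩
            have : r * Real.sin θ ≤ 0 := mul_nonpos_of_nonneg_of_nonpos hr.le
              (Real.sin_nonpos_of_nonpos_of_neg_pi_le h0 h'.1.le)
            rw [ENNReal.ofReal_of_nonpos this]
            simp
          · rw [Set.indicator_of_notMem h']
      · refine Measurable.aemeasurable ?_
        simp only [polarCoord_symm_apply, smul_eq_mul]
        refine (by fun_prop : Measurable fun a : ℝ × ℝ => ENNReal.ofReal a.1).mul
          (Measurable.mul (by fun_prop) (hm (by fun_prop) (by fun_prop) (by fun_prop)))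
    · exact ((by fun_prop : Measurable fun a : ℝ × ℝ => ENNReal.ofReal a.2).mul
        (hm (by fun_prop) (by fun_prop) (by fun_prop))).aemeasurable
  · refine Measurable.aemeasurable ?_
    refine Measurable.lintegral_prod_right' (f := fun q : (ℝ × ℝ) × ℝ => ENNReal.ofReal q.2 *
      F !₂[q.2 * Real.cos q.1.2, q.2 * Real.sin q.1.2, q.1.1]) ?_
    exact (by fun_prop : Measurable fun a : (ℝ × ℝ) × ℝ => ENNReal.ofReal a.2).mul
        (hm (by fun_prop) (by fun_prop) (by fun_prop))

/-- Integration in spherical coordinates. -/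
theorem measurePreserving_sphPoint :
    MeasurePreserving (fun p : ℝ × ℝ × ℝ => sphPoint p.1 p.2.1 p.2.2)
      (radialMeasure.prod (polarMeasure.prod azimuthMeasure)) volume := by
  have hc : Continuous (fun p : ℝ × ℝ × ℝ => sphPoint p.1 p.2.1 p.2.2) :=
    continuous_sphPoint (by fun_prop) (by fun_prop) (by fun_prop)
  refine ⟨hc.measurable, Measure.ext_of_lintegral _ fun F hF => ?_⟩
  have hM : ∀ {X : Type} [TopologicalSpace X] [MeasurableSpace X] [BorelSpace X] {a b c : X → ℝ},
      Continuous a → Continuous b → Continuous c →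
      Measurable fun x => F (sphPoint (a x) (b x) (c x)) := fun ha hb hc =>
    hF.comp (continuous_sphPoint ha hb hc).measurable
  have hm : Measurable fun p : ℝ × ℝ × ℝ => F (sphPoint p.1 p.2.1 p.2.2) :=
    hM (by fun_prop) (by fun_prop) (by fun_prop)
  rw [lintegral_map hF hc.measurable, lintegral_prod _ hm.aemeasurable,
    lintegral_spherical F hF, radialMeasure, lintegral_withDensity_eq_lintegral_mul _
      (by fun_prop) hm.lintegral_prod_right']
  rw [lintegral_lintegral_swap]
  · refine lintegral_congr fun r => ?_
    have hmr : Measurable fun p : ℝ × ℝ => F (sphPoint r p.1 p.2) :=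
      hM (by fun_prop) (by fun_prop) (by fun_prop)
    have hθ : ∀ θ, ∫⁻ φ in Set.Ioo (-Real.pi) Real.pi, ENNReal.ofReal (r ^ 2) *
          (ENNReal.ofReal (Real.sin θ) * F (sphPoint r θ φ)) = ENNReal.ofReal (r ^ 2) *
          (ENNReal.ofReal (Real.sin θ) * ∫⁻ φ in Set.Ioo (-Real.pi) Real.pi,
            F (sphPoint r θ φ)) := fun θ => by
      have m1 : Measurable fun φ : ℝ => F (sphPoint r θ φ) :=
        hM (by fun_prop) (by fun_prop) (by fun_prop)
      rw [lintegral_const_mul _ (m1.const_mul _), lintegral_const_mul _ m1]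
    rw [lintegral_lintegral_swap]
    · simp_rw [hθ]
      have m2 : Measurable fun θ : ℝ => ENNReal.ofReal (Real.sin θ) *
          ∫⁻ φ in Set.Ioo (-Real.pi) Real.pi, F (sphPoint r θ φ) :=
        Measurable.mul (by fun_prop) hmr.lintegral_prod_right'
      rw [lintegral_const_mul _ m2, Pi.mul_apply, lintegral_prod _ hmr.aemeasurable, polarMeasure,
        lintegral_withDensity_eq_lintegral_mul _ (by fun_prop) hmr.lintegral_prod_right']
      rfl
    · exact Measurable.aemeasurable (Measurable.mul (by fun_prop)
        (Measurable.mul (by fun_prop) (hM (by fun_prop) (by fun_prop) (by fun_prop))))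
  · refine Measurable.aemeasurable ?_
    refine Measurable.lintegral_prod_right' (f := fun q : (ℝ × ℝ) × ℝ => ENNReal.ofReal (q.1.2 ^ 2)
      * (ENNReal.ofReal (Real.sin q.2) * F (sphPoint q.1.2 q.2 q.1.1))) ?_
    exact Measurable.mul (by fun_prop)
      (Measurable.mul (by fun_prop) (hM (by fun_prop) (by fun_prop) (by fun_prop)))

/-! ### One-dimensional inequalities behind the Poincaré inequality -/

/-- **Wirtinger's inequality** for mean-zero functions on the circle. -/
theorem wirtinger_inequality {f f' : ℝ → ℝ} (hf : ∀ x, HasDerivAt f (f' x) x)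
    (hf' : Continuous f') (hper : f (-Real.pi) = f Real.pi)
    (hmean : ∫ x in (-Real.pi)..Real.pi, f x = 0) :
    ∫ x in (-Real.pi)..Real.pi, f x ^ 2 ≤ ∫ x in (-Real.pi)..Real.pi, f' x ^ 2 := by
  have hpi := Real.pi_pos
  have hab : -Real.pi < Real.pi := by linarith
  have hfc : Continuous f := continuous_iff_continuousAt.2 fun x => (hf x).continuousAt
  have hL : ∀ {g : ℝ → ℝ}, Continuous g → MemLp (fun x => (g x : ℂ)) 2
      (volume.restrict (Set.Ioc (-Real.pi) Real.pi)) := fun {g} hg => by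
    obtain ⟨C, hC⟩ := (isCompact_Icc (a := -Real.pi) (b := Real.pi)).exists_bound_of_continuousOn
      hg.continuousOn
    refine MemLp.of_bound (by fun_prop) C ?_
    filter_upwards [ae_restrict_mem measurableSet_Ioc] with x hx
    rw [Complex.norm_real]
    exact hC x (Set.Ioc_subset_Icc_self hx)
  have h1 := hasSum_sq_fourierCoeffOn hab (hL hfc)
  have h2 := hasSum_sq_fourierCoeffOn hab (hL hf')
  -- Periodicity removes the boundary term, so for n ≠ 0 the n-th coefficient of f is that of f'
  -- divided by n in modulus; the zeroth one is the mean. Parseval then sums the comparison.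
  have hle : ∀ n : ℤ, ‖fourierCoeffOn hab (fun x => (f x : ℂ)) n‖ ^ 2
      ≤ ‖fourierCoeffOn hab (fun x => (f' x : ℂ)) n‖ ^ 2 := by
    intro n
    by_cases hn : n = 0
    · subst hn
      have : fourierCoeffOn hab (fun x => (f x : ℂ)) 0 = 0 := by
        rw [fourierCoeffOn_eq_integral]
        simp [intervalIntegral.integral_ofReal, hmean]
      rw [this]
      simp
    · rw [fourierCoeffOn_of_hasDerivAt hab hn (f := fun x => (f x : ℂ))
        (f' := fun x => (f' x : ℂ)) (fun x _ => (hf x).ofReal_comp)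
        ((Complex.continuous_ofReal.comp hf').intervalIntegrable _ _)]
      rw [hper, sub_self, mul_zero, zero_sub, norm_mul, norm_neg, norm_mul]
      have hn1 : (1 : ℝ) ≤ |(n : ℝ)| := by exact_mod_cast Int.one_le_abs hn
      have e : ‖1 / (-2 * (Real.pi : ℂ) * Complex.I * n)‖ = 1 / (2 * Real.pi * |(n : ℝ)|) := by
        simp [abs_of_pos hpi]
      have e2 : ‖((Real.pi : ℂ) - ((-Real.pi : ℝ) : ℂ))‖ = 2 * Real.pi := by
        rw [← Complex.ofReal_sub, Complex.norm_real, Real.norm_eq_abs, abs_of_pos (by linarith)]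
        ring
      rw [e, e2]
      gcongr
      rw [← mul_assoc]
      refine mul_le_of_le_one_left (norm_nonneg _) ?_
      rw [div_mul_eq_mul_div, one_mul, div_le_one (by positivity)]
      nlinarith
  have h3 := hasSum_le hle h1 h2
  simp only [smul_eq_mul, Complex.norm_real, Real.norm_eq_abs, sq_abs] at h3
  exact le_of_mul_le_mul_left h3 (by rw [inv_pos]; linarith)

/-- Replacing the mean m of f by the mean c of g costs 2π(m − c)², which Cauchy–Schwarz bounds by
∫(f − g)². It is meant for g equal to the restriction of f to the equator. -/
theorem integral_sub_const_sq_le {f f' : ℝ → ℝ} (hf : ∀ x, HasDerivAt f (f' x) x)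
    (hf' : Continuous f') (hper : f (-Real.pi) = f Real.pi) {g : ℝ → ℝ} (hg : Continuous g) :
    ∫ x in (-Real.pi)..Real.pi, (f x - (∫ y in (-Real.pi)..Real.pi, g y) / (2 * Real.pi)) ^ 2
      ≤ (∫ x in (-Real.pi)..Real.pi, f' x ^ 2)
        + ∫ x in (-Real.pi)..Real.pi, (f x - g x) ^ 2 := by
  have hpi := Real.pi_pos
  have hfc : Continuous f := continuous_iff_continuousAt.2 fun x => (hf x).continuousAt
  set m := (∫ y in (-Real.pi)..Real.pi, f y) / (2 * Real.pi) with hm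
  set c := (∫ y in (-Real.pi)..Real.pi, g y) / (2 * Real.pi) with hc
  have hmI : ∫ x in (-Real.pi)..Real.pi, (f x - m) = 0 := by
    rw [intervalIntegral.integral_sub (hfc.intervalIntegrable _ _) (by simp)]
    simp [hm]
    field_simp
    ring
  have hcI : ∫ x in (-Real.pi)..Real.pi, (g x - c) = 0 := by
    rw [intervalIntegral.integral_sub (hg.intervalIntegrable _ _) (by simp)]
    simp [hc]
    field_simp
    ring
  have h1 : ∫ x in (-Real.pi)..Real.pi, (f x - m) ^ 2 ≤ ∫ x in (-Real.pi)..Real.pi, f' x ^ 2 :=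
    wirtinger_inequality (fun x => (hf x).sub_const m) hf' (by rw [hper]) hmI
  have ii : ∀ {h : ℝ → ℝ}, Continuous h → IntervalIntegrable h volume (-Real.pi) Real.pi :=
    fun hh => hh.intervalIntegrable _ _
  have h2 : ∫ x in (-Real.pi)..Real.pi, (f x - c) ^ 2
      = (∫ x in (-Real.pi)..Real.pi, (f x - m) ^ 2) + (m - c) ^ 2 * (2 * Real.pi) := by
    have e : ∀ x, (f x - c) ^ 2 = (f x - m) ^ 2 + 2 * (m - c) * (f x - m) + (m - c) ^ 2 :=
      fun x => by ring
    simp_rw [e]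
    rw [intervalIntegral.integral_add (ii (by fun_prop)) (ii (by fun_prop)),
      intervalIntegral.integral_add (ii (by fun_prop)) (ii (by fun_prop)),
      intervalIntegral.integral_const_mul, hmI]
    simp
    ring
  have h3 : (m - c) ^ 2 * (2 * Real.pi) ≤ ∫ x in (-Real.pi)..Real.pi, (f x - g x) ^ 2 := by
    have e : ∀ x, (f x - g x) ^ 2 = (f x - m - (g x - c)) ^ 2
        + 2 * (m - c) * ((f x - m) - (g x - c)) + (m - c) ^ 2 := fun x => by ring
    simp_rw [e]
    rw [intervalIntegral.integral_add (ii (by fun_prop)) (ii (by fun_prop)),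
      intervalIntegral.integral_add (ii (by fun_prop)) (ii (by fun_prop)),
      intervalIntegral.integral_const_mul,
      intervalIntegral.integral_sub (ii (by fun_prop)) (ii (by fun_prop)), hmI, hcI]
    have : 0 ≤ ∫ x in (-Real.pi)..Real.pi, (f x - m - (g x - c)) ^ 2 :=
      intervalIntegral.integral_nonneg (by linarith) fun x _ => sq_nonneg _
    simp
    linarith
  linarith

/-- A Poincaré inequality on the hemisphere, for functions of the polar angle that vanish at the
equator. -/
theorem integral_hemisphere_le {g g' : ℝ → ℝ} (hg : ∀ x, HasDerivAt g (g' x) x)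
    (hg' : Continuous g') (h0 : g (Real.pi / 2) = 0) :
    ∫ x in (0)..(Real.pi / 2), Real.sin x * g x ^ 2
      ≤ 2 * ∫ x in (0)..(Real.pi / 2), Real.sin x * g' x ^ 2 := by
  have hpi := Real.pi_pos
  have hgc : Continuous g := continuous_iff_continuousAt.2 fun x => (hg x).continuousAt
  have hcos : ∀ x ∈ Set.Icc 0 (Real.pi / 2), 0 ≤ Real.cos x := fun x hx =>
    Real.cos_nonneg_of_mem_Icc ⟨by linarith [hx.1], hx.2⟩
  -- q = tan²(x/2). The total derivative (q g²)' integrates to zero, since q vanishes at the pole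
  -- and g at the equator, so it can be added freely to complete a square.
  set q : ℝ → ℝ := fun x => (1 - Real.cos x) / (1 + Real.cos x) with hq
  set q' : ℝ → ℝ := fun x => 2 * Real.sin x / (1 + Real.cos x) ^ 2 with hq'
  have hd : ∀ x ∈ Set.uIcc 0 (Real.pi / 2), HasDerivAt (fun x => q x * g x ^ 2)
      (q' x * g x ^ 2 + q x * (2 * g x * g' x)) x := by
    intro x hx
    rw [Set.uIcc_of_le (by positivity)] at hx
    have h1 : 1 + Real.cos x ≠ 0 := by linarith [hcos x hx]
    have h2 : HasDerivAt q (q' x) x := by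
      have := ((Real.hasDerivAt_cos x).const_sub 1).div ((Real.hasDerivAt_cos x).const_add 1) h1
      refine this.congr_deriv ?_
      rw [hq']
      congr 1
      ring
    refine (h2.mul ((hg x).pow 2)).congr_deriv ?_
    simp
  have hqc : ContinuousOn q (Set.uIcc 0 (Real.pi / 2)) := by
    rw [Set.uIcc_of_le (by positivity)]
    refine ContinuousOn.div (by fun_prop) (by fun_prop) fun x hx => ?_
    linarith [hcos x hx]
  have hqc' : ContinuousOn q' (Set.uIcc 0 (Real.pi / 2)) := by
    rw [Set.uIcc_of_le (by positivity)]
    refine ContinuousOn.div (by fun_prop) (by fun_prop) fun x hx => ?_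
    have := hcos x hx
    positivity
  have hint : IntervalIntegrable (fun x => q' x * g x ^ 2 + q x * (2 * g x * g' x)) volume 0
      (Real.pi / 2) := ContinuousOn.intervalIntegrable (by fun_prop)
  have hF := intervalIntegral.integral_eq_sub_of_hasDerivAt hd hint
  have hF0 : ∫ x in (0)..(Real.pi / 2), (q' x * g x ^ 2 + q x * (2 * g x * g' x)) = 0 := by
    rw [hF, h0]
    simp [hq]
  have hi1 : IntervalIntegrable (fun x => Real.sin x * g' x ^ 2) volume 0 (Real.pi / 2) :=
    (by fun_prop : Continuous _).intervalIntegrable _ _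
  have hi2 : IntervalIntegrable (fun x => Real.sin x * g x ^ 2) volume 0 (Real.pi / 2) :=
    (by fun_prop : Continuous _).intervalIntegrable _ _
  have key : ∫ x in (0)..(Real.pi / 2), Real.sin x * g x ^ 2
      ≤ ∫ x in (0)..(Real.pi / 2), (2 * (Real.sin x * g' x ^ 2)
        + 2 * (q' x * g x ^ 2 + q x * (2 * g x * g' x))) := by
    refine intervalIntegral.integral_mono_on (by positivity) hi2
      ((hi1.const_mul 2).add (hint.const_mul 2)) fun x hx => ?_
    have hc := hcos x hx
    have hs : 0 ≤ Real.sin x := Real.sin_nonneg_of_nonneg_of_le_pi hx.1 (by linarith [hx.2])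
    have hsc := Real.sin_sq_add_cos_sq x
    have hc1 := Real.cos_le_one x
    rcases hs.eq_or_lt with h | h
    · have hc2 : Real.cos x = 1 := by
        rw [← h] at hsc
        nlinarith
      simp only [hq, hq', hc2, ← h]
      simp
    · set s := Real.sin x
      set c := Real.cos x
      -- sin x times the difference of the integrands is, up to the factor 2, (s g' + q g)² plus
      -- this expression times g².
      have hqs : 0 ≤ q' x * s - q x ^ 2 - s ^ 2 / 2 := by
        have e : q' x * s - q x ^ 2 - s ^ 2 / 2
            = (1 - c) * (1 + 3 * c - (1 + c) ^ 3 / 2) / (1 + c) ^ 2 := by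
          have : s ^ 2 = 1 - c ^ 2 := by linarith
          have h1 : 1 + c ≠ 0 := by linarith
          simp only [hq, hq']
          change 2 * s / (1 + c) ^ 2 * s - ((1 - c) / (1 + c)) ^ 2 - s ^ 2 / 2 = _
          have e1 : 2 * s / (1 + c) ^ 2 * s = 2 * s ^ 2 / (1 + c) ^ 2 := by ring
          rw [e1, this]
          field_simp
          ring
        rw [e]
        have : 0 ≤ 1 + 3 * c - (1 + c) ^ 3 / 2 := by
          nlinarith [mul_nonneg hc (sub_nonneg.2 hc1),
            mul_nonneg (mul_nonneg hc (sub_nonneg.2 hc1)) hc]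
        have : 0 ≤ 1 - c := by linarith
        positivity
      have h4 : 0 ≤ s * (s * g' x ^ 2 + (q' x * g x ^ 2 + q x * (2 * g x * g' x))
          - s * g x ^ 2 / 2) := by
        have e : s * (s * g' x ^ 2 + (q' x * g x ^ 2 + q x * (2 * g x * g' x))
          - s * g x ^ 2 / 2) = (s * g' x + q x * g x) ^ 2
            + (q' x * s - q x ^ 2 - s ^ 2 / 2) * g x ^ 2 := by ring
        rw [e]
        positivity
      have h5 := nonneg_of_mul_nonneg_right h4 h
      linarith
  rw [intervalIntegral.integral_add (hi1.const_mul 2) (hint.const_mul 2),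
    intervalIntegral.integral_const_mul, intervalIntegral.integral_const_mul, hF0] at key
  linarith

/-- The second hemisphere is the image of the first under x ↦ π − x. -/
theorem integral_polar_angle_le {g g' : ℝ → ℝ} (hg : ∀ x, HasDerivAt g (g' x) x)
    (hg' : Continuous g') :
    ∫ x in (0)..Real.pi, Real.sin x * (g x - g (Real.pi / 2)) ^ 2
      ≤ 2 * ∫ x in (0)..Real.pi, Real.sin x * g' x ^ 2 := by
  have hgc : Continuous g := continuous_iff_continuousAt.2 fun x => (hg x).continuousAt
  have h1 := integral_hemisphere_le (fun x => (hg x).sub_const (g (Real.pi / 2))) hg' (by simp)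
  have h2 := integral_hemisphere_le (g := fun x => g (Real.pi - x) - g (Real.pi / 2))
    (g' := fun x => - g' (Real.pi - x))
    (fun x => by
      have := (hg (Real.pi - x)).comp x ((hasDerivAt_id x).const_sub Real.pi)
      simpa using this.sub_const (g (Real.pi / 2)))
    (by fun_prop) (by rw [sub_half, sub_self])
  have hr : ∀ h : ℝ → ℝ, ∫ x in (0)..(Real.pi / 2), Real.sin x * h (Real.pi - x)
      = ∫ x in (Real.pi / 2)..Real.pi, Real.sin x * h x := by
    intro h
    have := intervalIntegral.integral_comp_sub_left (a := 0) (b := Real.pi / 2)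
      (fun x => Real.sin x * h x) Real.pi
    simp only [Real.sin_pi_sub, sub_half, sub_zero] at this
    exact this
  have ii : ∀ {h : ℝ → ℝ} {a b : ℝ}, Continuous h → IntervalIntegrable h volume a b :=
    fun hh => hh.intervalIntegrable _ _
  simp only [neg_sq] at h2
  rw [hr fun x => (g x - g (Real.pi / 2)) ^ 2, hr fun x => g' x ^ 2] at h2
  rw [← intervalIntegral.integral_add_adjacent_intervals (b := Real.pi / 2) (ii (by fun_prop))
    (ii (by fun_prop)), ← intervalIntegral.integral_add_adjacent_intervals (a := 0)
    (b := Real.pi / 2) (c := Real.pi) (f := fun x => Real.sin x * g' x ^ 2) (ii (by fun_prop))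
    (ii (by fun_prop))]
  linarith

/-! ### Angular integrals and the Poincaré inequality on the sphere -/

theorem integral_polarMeasure (g : ℝ → ℝ) :
    ∫ θ, g θ ∂polarMeasure = ∫ θ in (0)..Real.pi, Real.sin θ * g θ := by
  rw [polarMeasure, integral_withDensity_eq_integral_toReal_smul (by fun_prop)
    (Filter.Eventually.of_forall fun _ => ENNReal.ofReal_lt_top),
    intervalIntegral.integral_of_le Real.pi_pos.le, integral_Ioc_eq_integral_Ioo]
  refine setIntegral_congr_fun measurableSet_Ioo fun θ hθ => ?_
  simp only [smul_eq_mul]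
  rw [ENNReal.toReal_ofReal (Real.sin_pos_of_mem_Ioo hθ).le]

theorem integral_azimuthMeasure (g : ℝ → ℝ) :
    ∫ φ, g φ ∂azimuthMeasure = ∫ φ in (-Real.pi)..Real.pi, g φ := by
  rw [azimuthMeasure, intervalIntegral.integral_of_le (by linarith [Real.pi_pos]),
    integral_Ioc_eq_integral_Ioo]

theorem integral_radialMeasure (g : ℝ → ℝ) :
    ∫ r, g r ∂radialMeasure = ∫ r in Set.Ioi 0, r ^ 2 * g r := by
  rw [radialMeasure, integral_withDensity_eq_integral_toReal_smul (by fun_prop)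
    (Filter.Eventually.of_forall fun _ => ENNReal.ofReal_lt_top)]
  refine setIntegral_congr_fun measurableSet_Ioi fun r hr => ?_
  simp only [smul_eq_mul]
  rw [ENNReal.toReal_ofReal (sq_nonneg r)]

theorem ae_polarMeasure_mem : ∀ᵐ θ ∂polarMeasure, θ ∈ Set.Ioo 0 Real.pi :=
  (withDensity_absolutelyContinuous _ _).ae_le (ae_restrict_mem measurableSet_Ioo)

theorem ae_azimuthMeasure_mem : ∀ᵐ φ ∂azimuthMeasure, φ ∈ Set.Ioo (-Real.pi) Real.pi :=
  ae_restrict_mem measurableSet_Ioo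

theorem ae_radialMeasure_mem : ∀ᵐ r ∂radialMeasure, r ∈ Set.Ioi (0 : ℝ) :=
  (withDensity_absolutelyContinuous _ _).ae_le (ae_restrict_mem measurableSet_Ioi)

instance : IsFiniteMeasure polarMeasure := by
  unfold polarMeasure
  refine isFiniteMeasure_withDensity_ofReal ?_
  exact ((Real.continuous_sin.integrableOn_Icc (a := 0) (b := Real.pi)).mono_set
    Set.Ioo_subset_Icc_self).2

instance : IsFiniteMeasure azimuthMeasure := by unfold azimuthMeasure; infer_instance

theorem integrable_angular {f : ℝ × ℝ → ℝ} (hf : Continuous f) :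
    Integrable f (polarMeasure.prod azimuthMeasure) := by
  obtain ⟨C, hC⟩ := ((isCompact_Icc (a := (0 : ℝ)) (b := Real.pi)).prod
    (isCompact_Icc (a := -Real.pi) (b := Real.pi))).exists_bound_of_continuousOn hf.continuousOn
  refine Integrable.of_bound hf.aestronglyMeasurable C ?_
  filter_upwards [Measure.quasiMeasurePreserving_fst.ae ae_polarMeasure_mem,
    Measure.quasiMeasurePreserving_snd.ae ae_azimuthMeasure_mem] with p h1 h2
  exact hC p ⟨Set.Ioo_subset_Icc_self h1, Set.Ioo_subset_Icc_self h2⟩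

theorem integral_angular {f : ℝ × ℝ → ℝ} (hf : Continuous f) :
    ∫ p, f p ∂(polarMeasure.prod azimuthMeasure)
      = ∫ θ in (0)..Real.pi, Real.sin θ * ∫ φ in (-Real.pi)..Real.pi, f (θ, φ) := by
  rw [integral_prod _ (integrable_angular hf), integral_polarMeasure]
  simp_rw [integral_azimuthMeasure]

theorem integral_angular_mono_left {F G : ℝ × ℝ → ℝ} (hF : Continuous F) (hG : Continuous G)
    (h : ∀ θ, ∫ φ in (-Real.pi)..Real.pi, F (θ, φ) ≤ ∫ φ in (-Real.pi)..Real.pi, G (θ, φ)) :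
    ∫ p, F p ∂(polarMeasure.prod azimuthMeasure)
      ≤ ∫ p, G p ∂(polarMeasure.prod azimuthMeasure) := by
  rw [integral_prod _ (integrable_angular hF), integral_prod _ (integrable_angular hG)]
  refine integral_mono (integrable_angular hF).integral_prod_left
    (integrable_angular hG).integral_prod_left fun θ => ?_
  simp only [integral_azimuthMeasure]
  exact h θ

theorem integral_angular_mono_right {F G : ℝ × ℝ → ℝ} (hF : Continuous F) (hG : Continuous G)
    (h : ∀ φ, ∫ θ in (0)..Real.pi, Real.sin θ * F (θ, φ)
      ≤ ∫ θ in (0)..Real.pi, Real.sin θ * G (θ, φ)) :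
    ∫ p, F p ∂(polarMeasure.prod azimuthMeasure)
      ≤ ∫ p, G p ∂(polarMeasure.prod azimuthMeasure) := by
  rw [integral_prod_symm _ (integrable_angular hF), integral_prod_symm _ (integrable_angular hG)]
  refine integral_mono (integrable_angular hF).integral_prod_right
    (integrable_angular hG).integral_prod_right fun φ => ?_
  simp only [integral_polarMeasure]
  exact h φ

/-- A Poincaré inequality on the sphere, in spherical coordinates, with the mean over the equator
as reference value. -/
theorem integral_angular_poincare {f fθ fφ : ℝ × ℝ → ℝ} (hfc : Continuous f)
    (hθ : ∀ θ φ, HasDerivAt (fun t => f (t, φ)) (fθ (θ, φ)) θ)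
    (hφ : ∀ θ φ, HasDerivAt (fun t => f (θ, t)) (fφ (θ, φ)) φ)
    (hθc : Continuous fθ) (hφc : Continuous fφ) (hper : ∀ θ, f (θ, -Real.pi) = f (θ, Real.pi)) :
    ∫ p, (f p - (∫ y in (-Real.pi)..Real.pi, f (Real.pi / 2, y)) / (2 * Real.pi)) ^ 2
        ∂(polarMeasure.prod azimuthMeasure)
      ≤ ∫ p, (fφ p ^ 2 + 2 * fθ p ^ 2) ∂(polarMeasure.prod azimuthMeasure) := by
  -- On each circle of latitude f is compared with the equatorial mean. The leftover f(θ, φ) −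
  -- f(π/2, φ) vanishes on the equator and is bounded along meridians.
  have h1 : ∫ p, (f p - (∫ y in (-Real.pi)..Real.pi, f (Real.pi / 2, y)) / (2 * Real.pi)) ^ 2
        ∂(polarMeasure.prod azimuthMeasure)
      ≤ ∫ p, (fφ p ^ 2 + (f p - f (Real.pi / 2, p.2)) ^ 2)
        ∂(polarMeasure.prod azimuthMeasure) := by
    refine integral_angular_mono_left (by fun_prop) (by fun_prop) fun θ => ?_
    rw [intervalIntegral.integral_add ((by fun_prop : Continuous _).intervalIntegrable _ _)
      ((by fun_prop : Continuous _).intervalIntegrable _ _)]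
    exact integral_sub_const_sq_le (hφ θ) (by fun_prop) (hper θ) (by fun_prop)
  refine h1.trans ?_
  rw [integral_add (integrable_angular (by fun_prop)) (integrable_angular (by fun_prop)),
    integral_add (integrable_angular (by fun_prop)) (integrable_angular (by fun_prop))]
  refine add_le_add le_rfl ?_
  refine integral_angular_mono_right (by fun_prop) (by fun_prop) fun φ => ?_
  refine (integral_polar_angle_le (fun θ => hθ θ φ) (by fun_prop)).trans_eq ?_
  rw [← intervalIntegral.integral_const_mul]
  congr 1
  ext θ
  ring

/-! ### Partial derivatives -/

theorem fderiv_apply_eq_sum (w : E3 → ℝ) (x v : E3) :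
    fderiv ℝ w x v = ∑ k : Fin 3, v k * partialD k w x := by
  have hv : v = ∑ k : Fin 3, v k • EuclideanSpace.single k (1 : ℝ) := by
    ext i
    simp [Fin.sum_univ_three, PiLp.single_apply]
    fin_cases i <;> simp
  conv_lhs => rw [hv]
  simp [map_sum, partialD]

theorem hasDerivAt_e3_mk {a b c : ℝ → ℝ} {a' b' c' t : ℝ} (ha : HasDerivAt a a' t)
    (hb : HasDerivAt b b' t) (hc : HasDerivAt c c' t) :
    HasDerivAt (fun s => (!₂[a s, b s, c s] : E3)) !₂[a', b', c'] t := by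
  have : HasDerivAt (fun s => ![a s, b s, c s]) ![a', b', c'] t := by
    rw [hasDerivAt_pi]
    intro i
    fin_cases i <;> simpa
  exact ((PiLp.continuousLinearEquiv 2 ℝ fun _ : Fin 3 => ℝ).symm.hasFDerivAt).comp_hasDerivAt t
    this

theorem hasDerivAt_comp_e3_mk {w : E3 → ℝ} (hw : Differentiable ℝ w) {a b c : ℝ → ℝ}
    {a' b' c' t : ℝ} (ha : HasDerivAt a a' t) (hb : HasDerivAt b b' t) (hc : HasDerivAt c c' t) :
    HasDerivAt (fun s => w !₂[a s, b s, c s])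
      (a' * partialD 0 w !₂[a t, b t, c t] + b' * partialD 1 w !₂[a t, b t, c t]
        + c' * partialD 2 w !₂[a t, b t, c t]) t := by
  have h := (hw _).hasFDerivAt.comp_hasDerivAt t (hasDerivAt_e3_mk ha hb hc)
  rw [fderiv_apply_eq_sum, Fin.sum_univ_three] at h
  exact h

theorem contDiff_partialD {w : E3 → ℝ} (hw : ContDiff ℝ ∞ w) (k : Fin 3) :
    ContDiff ℝ ∞ (partialD k w) :=
  (hw.fderiv_right (m := ∞) (by simp)).clm_apply contDiff_const

theorem hasCompactSupport_partialD {w : E3 → ℝ} (hw : HasCompactSupport w) (k : Fin 3) :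
    HasCompactSupport (partialD k w) :=
  hw.fderiv_apply ℝ _

theorem hasLineDerivAt_partialD {w : E3 → ℝ} (hw : ContDiff ℝ ∞ w) (k : Fin 3) (x : E3) :
    HasLineDerivAt ℝ w (partialD k w x) x (EuclideanSpace.single k 1) :=
  ((hw.differentiable (by simp)) x).hasFDerivAt.hasLineDerivAt _

theorem partialD_mul {f g : E3 → ℝ} (hf : ContDiff ℝ ∞ f) (hg : ContDiff ℝ ∞ g) (k : Fin 3)
    (x : E3) : partialD k (fun y => f y * g y) x = partialD k f x * g x + f x * partialD k g x := by
  unfold partialD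
  rw [fderiv_fun_mul (hf.differentiable (by simp) x) (hg.differentiable (by simp) x)]
  simp
  ring

theorem norm_sq_e3 (x : E3) : ‖x‖ ^ 2 = x 0 ^ 2 + x 1 ^ 2 + x 2 ^ 2 := by
  rw [EuclideanSpace.real_norm_sq_eq, Fin.sum_univ_three]

theorem abs_apply_le_norm (x : E3) (i : Fin 3) : |x i| ≤ ‖x‖ := by
  simpa using PiLp.norm_apply_le x i

theorem HasLineDerivAt.fun_mul {f g : E3 → ℝ} {f' g' : ℝ} {x v : E3}
    (hf : HasLineDerivAt ℝ f f' x v) (hg : HasLineDerivAt ℝ g g' x v) :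
    HasLineDerivAt ℝ (fun y => f y * g y) (f' * g x + f x * g') x v := by
  have := HasDerivAt.mul hf hg
  simp only [zero_smul, add_zero] at this
  exact this

theorem HasLineDerivAt.fun_add {f g : E3 → ℝ} {f' g' : ℝ} {x v : E3}
    (hf : HasLineDerivAt ℝ f f' x v) (hg : HasLineDerivAt ℝ g g' x v) :
    HasLineDerivAt ℝ (fun y => f y + g y) (f' + g') x v :=
  HasDerivAt.add hf hg

theorem hasLineDerivAt_coord (i k : Fin 3) (x : E3) :
    HasLineDerivAt ℝ (fun y : E3 => y i) (if i = k then 1 else 0) x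
      (EuclideanSpace.single k 1) := by
  have : HasDerivAt (fun t : ℝ => x i + t * (if i = k then 1 else 0))
      (if i = k then 1 else 0) 0 := by
    simpa using ((hasDerivAt_id (0 : ℝ)).mul_const (if i = k then (1 : ℝ) else 0)).const_add (x i)
  unfold HasLineDerivAt
  simpa [PiLp.single_apply] using this

theorem hasLineDerivAt_inv_norm {x : E3} (hx : x ≠ 0) (k : Fin 3) :
    HasLineDerivAt ℝ (fun y : E3 => ‖y‖⁻¹) (-(x k * ‖x‖⁻¹ ^ 3)) x (EuclideanSpace.single k 1) := by
  have hn : ‖x‖ ≠ 0 := norm_ne_zero_iff.2 hx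
  have h1 := ((hasStrictFDerivAt_norm_sq x).hasFDerivAt.hasLineDerivAt
    (EuclideanSpace.single k (1 : ℝ)))
  unfold HasLineDerivAt at h1 ⊢
  have h2 := h1.sqrt (by simpa using hn)
  have h3 := h2.inv (by simpa using hn)
  simp only [Real.sqrt_sq (norm_nonneg _), zero_smul, add_zero] at h3
  refine h3.congr_deriv ?_
  simp [EuclideanSpace.inner_single_right]
  field_simp

/-! ### Integrability of functions with a mild singularity at the origin -/

/-- In dimension three the volume factor r² cancels the singularity |x|⁻². -/
theorem integrable_of_le_inv_norm_sq {F : E3 → ℝ} (hF : Measurable F) {C R : ℝ}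
    (hb : ∀ x, x ≠ 0 → ‖x‖ ≤ R → |F x| ≤ C * ‖x‖⁻¹ ^ 2) (h0 : ∀ x, R < ‖x‖ → F x = 0) :
    Integrable F := by
  have h1 : Integrable (fun x : E3 => (Set.Iic R).indicator (fun y : ℝ => C * y⁻¹ ^ 2) ‖x‖) := by
    rw [integrable_fun_norm_addHaar (volume : Measure E3)
      (f := (Set.Iic R).indicator (fun y : ℝ => C * y⁻¹ ^ 2))]
    have h2 : IntegrableOn ((Set.Ioc 0 R).indicator fun _ : ℝ => C) (Set.Ioi 0) := by
      rw [integrableOn_indicator_iff measurableSet_Ioc]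
      exact (integrableOn_const (by simp)).mono_set Set.inter_subset_left
    refine h2.congr_fun (fun y hy => ?_) measurableSet_Ioi
    have hy : 0 < y := hy
    by_cases hyR : y ≤ R
    · rw [Set.indicator_of_mem (by exact ⟨hy, hyR⟩)]
      simp only [finrank_euclideanSpace, Fintype.card_fin, smul_eq_mul]
      rw [Set.indicator_of_mem (by exact hyR)]
      norm_num
      field_simp
    · rw [Set.indicator_of_notMem (fun h => hyR h.2)]
      simp only [smul_eq_mul]
      rw [Set.indicator_of_notMem (by exact hyR), mul_zero]
  refine h1.mono' hF.aestronglyMeasurable ?_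
  filter_upwards [Measure.ae_ne volume (0 : E3)] with x hx
  by_cases hxR : ‖x‖ ≤ R
  · rw [Set.indicator_of_mem (by exact hxR)]
    exact hb x hx hxR
  · rw [Set.indicator_of_notMem (by exact hxR), h0 x (not_le.1 hxR), norm_zero]

theorem exists_bound_and_radius {g : E3 → ℝ} (hg : Continuous g) (hs : HasCompactSupport g) :
    ∃ C R : ℝ, 0 ≤ C ∧ 0 < R ∧ (∀ x, |g x| ≤ C) ∧ ∀ x, R < ‖x‖ → g x = 0 := by
  obtain ⟨C, hC⟩ := hs.exists_bound_of_continuous hg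
  obtain ⟨R, hR⟩ := hs.isCompact.isBounded.exists_norm_le
  refine ⟨C, max R 1, (norm_nonneg _).trans (hC 0), by positivity, hC, fun x hx => ?_⟩
  by_contra h
  exact ((le_max_left R 1).trans_lt hx).not_ge (hR x (subset_tsupport _ h))

theorem integrable_mul_of_le_inv_norm {g K : E3 → ℝ} (hg : Continuous g)
    (hs : HasCompactSupport g) (hK : Measurable K) {C : ℝ} {n : ℕ} (hn : n ≤ 2)
    (hb : ∀ x, x ≠ 0 → |K x| ≤ C * ‖x‖⁻¹ ^ n) : Integrable fun x => g x * K x := by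
  obtain ⟨M, R, hM0, hR, hM, h0⟩ := exists_bound_and_radius hg hs
  refine integrable_of_le_inv_norm_sq (hg.measurable.mul hK) (C := M * (|C| * R ^ (2 - n)))
    (R := R) (fun x hx hxR => ?_) fun x hx => by rw [h0 x hx, zero_mul]
  have hx' : 0 < ‖x‖ := norm_pos_iff.2 hx
  rw [abs_mul, mul_assoc]
  refine mul_le_mul (hM x) ?_ (abs_nonneg _) hM0
  refine (hb x hx).trans ?_
  have e : ‖x‖⁻¹ ^ n = ‖x‖ ^ (2 - n) * ‖x‖⁻¹ ^ 2 := by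
    obtain ⟨m, hm⟩ := Nat.exists_eq_add_of_le hn
    have : 2 - n = m := by omega
    rw [this]
    conv_rhs => rw [hm]
    rw [pow_add, mul_left_comm, ← mul_pow, mul_inv_cancel₀ hx'.ne', one_pow, mul_one]
  rw [e, ← mul_assoc]
  refine mul_le_mul_of_nonneg_right ?_ (by positivity)
  exact mul_le_mul (le_abs_self C) (pow_le_pow_left₀ hx'.le hxR _) (by positivity) (abs_nonneg C)

/-! ### Integration by parts across the origin -/

/-- The integral of a partial derivative of a compactly supported function that is differentiable
off the origin vanishes as soon as this partial derivative is integrable. -/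
theorem integral_eq_zero_of_hasLineDerivAt {G G' : E3 → ℝ} (k : Fin 3)
    (hG : ∀ x, x ≠ 0 → HasLineDerivAt ℝ G (G' x) x (EuclideanSpace.single k 1)) {R : ℝ}
    (h0 : ∀ x, R < ‖x‖ → G x = 0) (hG' : Integrable G') : ∫ x, G' x = 0 := by
  let Ψ : ℝ × (Fin 2 → ℝ) → E3 := fun q => WithLp.toLp 2 (Fin.insertNth k q.1 q.2)
  let e : ℝ × (Fin 2 → ℝ) ≃ᵐ E3 :=
    (MeasurableEquiv.piFinSuccAbove (fun _ : Fin 3 => ℝ) k).symm.trans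
      (MeasurableEquiv.toLp 2 (Fin 3 → ℝ))
  have he : ⇑e = Ψ := rfl
  have hΨ : MeasurePreserving e (volume.prod volume) volume :=
    (PiLp.volume_preserving_toLp (Fin 3)).comp
      (volume_preserving_piFinSuccAbove (fun _ : Fin 3 => ℝ) k).symm
  rw [← hΨ.integral_comp e.measurableEmbedding]
  have hint : Integrable (fun q => G' (e q)) (volume.prod volume) :=
    (hΨ.integrable_comp_emb e.measurableEmbedding).2 hG'
  rw [integral_prod_symm _ hint]
  refine integral_eq_zero_of_ae ?_
  -- Almost every line parallel to the k-th axis misses the origin, and on such a line the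
  -- fundamental theorem of calculus applies without a singularity.
  filter_upwards [hint.prod_left_ae, Measure.ae_ne volume (0 : Fin 2 → ℝ)] with y hy hy0
  have hk : ∀ t, Ψ (t, y) k = t := fun t => by simp [Ψ]
  have hne : ∀ t, Ψ (t, y) ≠ 0 := fun t h => by
    apply hy0
    ext i
    have : Ψ (t, y) (k.succAbove i) = 0 := by rw [h]; rfl
    simpa [Ψ] using this
  have hadd : ∀ t s, Ψ (t, y) + s • EuclideanSpace.single k (1 : ℝ) = Ψ (t + s, y) := fun t s => by
    ext i
    rcases Fin.eq_self_or_eq_succAbove k i with rfl | ⟨j, rfl⟩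
    · simp [Ψ]
    · simp [Ψ]
  have hd : ∀ t, HasDerivAt (fun t => G (Ψ (t, y))) (G' (Ψ (t, y))) t := fun t => by
    have h1 := hG _ (hne t)
    unfold HasLineDerivAt at h1
    simp only [hadd] at h1
    have h2 := HasDerivAt.comp_sub_const (f := fun s => G (Ψ (t + s, y))) t t (by simpa using h1)
    simpa using h2
  have hz : ∀ t, R < |t| → G (Ψ (t, y)) = 0 := fun t ht => by
    refine h0 _ (ht.trans_le ?_)
    have := abs_apply_le_norm (Ψ (t, y)) k
    rwa [hk] at this
  have := integral_of_hasDerivAt_of_tendsto hd hy (m := 0) (n := 0)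
    (tendsto_const_nhds.congr' ?_) (tendsto_const_nhds.congr' ?_)
  · simpa [he] using this
  · filter_upwards [Filter.eventually_lt_atBot (-R), Filter.eventually_lt_atBot 0] with t ht ht0
    rw [hz t (by rw [abs_of_neg ht0]; linarith)]
  · filter_upwards [Filter.eventually_gt_atTop R, Filter.eventually_gt_atTop 0] with t ht ht0
    rw [hz t (by rw [abs_of_pos ht0]; linarith)]

/-! ### Integrals in spherical coordinates -/

@[simp] theorem sphPoint_zero_apply (r θ φ : ℝ) :
    sphPoint r θ φ 0 = r * (Real.sin θ * Real.cos φ) := rfl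

@[simp] theorem sphPoint_one_apply (r θ φ : ℝ) :
    sphPoint r θ φ 1 = r * (Real.sin θ * Real.sin φ) := rfl

@[simp] theorem sphPoint_two_apply (r θ φ : ℝ) : sphPoint r θ φ 2 = r * Real.cos θ := rfl

theorem norm_sphPoint (r θ φ : ℝ) : ‖sphPoint r θ φ‖ = |r| := by
  rw [← abs_of_nonneg (norm_nonneg (sphPoint r θ φ)), ← sq_eq_sq_iff_abs_eq_abs, norm_sq_e3]
  simp only [sphPoint_zero_apply, sphPoint_one_apply, sphPoint_two_apply]
  linear_combination r ^ 2 * Real.sin θ ^ 2 * Real.sin_sq_add_cos_sq φ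
    + r ^ 2 * Real.sin_sq_add_cos_sq θ

theorem integrable_comp_sphPoint {F : E3 → ℝ} (hF : Integrable F) :
    Integrable (fun p : ℝ × ℝ × ℝ => F (sphPoint p.1 p.2.1 p.2.2))
      (radialMeasure.prod (polarMeasure.prod azimuthMeasure)) :=
  (measurePreserving_sphPoint.integrable_comp hF.aestronglyMeasurable).2 hF

theorem integral_comp_sphPoint {F : E3 → ℝ} (hF : Integrable F) :
    ∫ p : ℝ × ℝ × ℝ, F (sphPoint p.1 p.2.1 p.2.2)
      ∂(radialMeasure.prod (polarMeasure.prod azimuthMeasure)) = ∫ x, F x := by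
  have h := measurePreserving_sphPoint
  rw [← h.map_eq, integral_map h.aemeasurable]
  rw [h.map_eq]
  exact hF.aestronglyMeasurable

theorem hasDerivAt_comp_sphPoint_radius {w : E3 → ℝ} (hw : Differentiable ℝ w) (r θ φ : ℝ) :
    HasDerivAt (fun t => w (sphPoint t θ φ))
      (Real.sin θ * Real.cos φ * partialD 0 w (sphPoint r θ φ)
        + Real.sin θ * Real.sin φ * partialD 1 w (sphPoint r θ φ)
        + Real.cos θ * partialD 2 w (sphPoint r θ φ)) r := by
  have h : ∀ c : ℝ, HasDerivAt (fun t => t * c) c r := fun c => by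
    simpa using (hasDerivAt_id r).mul_const c
  exact hasDerivAt_comp_e3_mk hw (h _) (h _) (h _)

theorem hasDerivAt_comp_sphPoint_polar {w : E3 → ℝ} (hw : Differentiable ℝ w) (r θ φ : ℝ) :
    HasDerivAt (fun t => w (sphPoint r t φ))
      (r * (Real.cos θ * Real.cos φ) * partialD 0 w (sphPoint r θ φ)
        + r * (Real.cos θ * Real.sin φ) * partialD 1 w (sphPoint r θ φ)
        + r * (-Real.sin θ) * partialD 2 w (sphPoint r θ φ)) θ :=
  hasDerivAt_comp_e3_mk hw (((Real.hasDerivAt_sin θ).mul_const _).const_mul r)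
    (((Real.hasDerivAt_sin θ).mul_const _).const_mul r) ((Real.hasDerivAt_cos θ).const_mul r)

theorem hasDerivAt_comp_sphPoint_azimuth {w : E3 → ℝ} (hw : Differentiable ℝ w) (r θ φ : ℝ) :
    HasDerivAt (fun t => w (sphPoint r θ t))
      (r * (Real.sin θ * -Real.sin φ) * partialD 0 w (sphPoint r θ φ)
        + r * (Real.sin θ * Real.cos φ) * partialD 1 w (sphPoint r θ φ)
        + 0 * partialD 2 w (sphPoint r θ φ)) φ :=
  hasDerivAt_comp_e3_mk hw (((Real.hasDerivAt_cos φ).const_mul _).const_mul r)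
    (((Real.hasDerivAt_sin φ).const_mul _).const_mul r) (hasDerivAt_const φ _)

theorem continuous_partialD {w : E3 → ℝ} (hw : ContDiff ℝ ∞ w) (k : Fin 3) :
    Continuous (partialD k w) := (contDiff_partialD hw k).continuous

theorem integrable_inv_norm_cube_mul_euler {w K : E3 → ℝ} (hw : ContDiff ℝ ∞ w)
    (hs : HasCompactSupport w) (hK : Measurable K) {C : ℝ} (hC : ∀ x, |K x| ≤ C) :
    Integrable fun x => ‖x‖⁻¹ ^ 3 * (∑ k : Fin 3, x k * partialD k w x) * K x := by
  have h : ∀ k : Fin 3, Integrable fun x => partialD k w x * (‖x‖⁻¹ ^ 3 * x k * K x) := fun k => by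
    refine integrable_mul_of_le_inv_norm (continuous_partialD hw k)
      (hasCompactSupport_partialD hs k) (by fun_prop) le_rfl (C := C) fun x hx => ?_
    have hx' : 0 < ‖x‖ := norm_pos_iff.2 hx
    rw [abs_mul, abs_mul, abs_of_nonneg (by positivity : 0 ≤ ‖x‖⁻¹ ^ 3)]
    calc ‖x‖⁻¹ ^ 3 * |x k| * |K x| ≤ ‖x‖⁻¹ ^ 3 * ‖x‖ * C := by
          gcongr
          · exact abs_apply_le_norm x k
          · exact hC x
      _ = C * ‖x‖⁻¹ ^ 2 := by field_simp
  refine (integrable_finsetSum Finset.univ fun k _ => h k).congr ?_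
  refine Filter.Eventually.of_forall fun x => ?_
  simp only [Finset.mul_sum, Finset.sum_mul]
  exact Finset.sum_congr rfl fun k _ => by ring

/-- Integration along rays: the singular weight `|x|⁻³` recovers the value at the origin. -/
theorem integral_inv_norm_cube_mul_euler {w K : E3 → ℝ} (hw : ContDiff ℝ ∞ w)
    (hs : HasCompactSupport w) (hK : Measurable K) {C : ℝ} (hC : ∀ x, |K x| ≤ C)
    {κ : ℝ × ℝ → ℝ} (hκ : ∀ r > 0, ∀ θ φ, K (sphPoint r θ φ) = κ (θ, φ)) :
    ∫ x, ‖x‖⁻¹ ^ 3 * (∑ k : Fin 3, x k * partialD k w x) * K x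
      = -w 0 * ∫ p, κ p ∂(polarMeasure.prod azimuthMeasure) := by
  have hint := integrable_inv_norm_cube_mul_euler hw hs hK hC
  rw [← integral_comp_sphPoint hint, integral_prod_symm _ (integrable_comp_sphPoint hint),
    ← integral_const_mul]
  refine integral_congr_ae (Filter.Eventually.of_forall fun p => ?_)
  obtain ⟨θ, φ⟩ := p
  simp only
  have hwd := hw.differentiable (by simp)
  obtain ⟨M, R, hM, hR, -, h0⟩ := exists_bound_and_radius hw.continuous hs
  set f' : ℝ → ℝ := fun r => Real.sin θ * Real.cos φ * partialD 0 w (sphPoint r θ φ)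
        + Real.sin θ * Real.sin φ * partialD 1 w (sphPoint r θ φ)
        + Real.cos θ * partialD 2 w (sphPoint r θ φ) with hf'
  have hcurve : Continuous fun r => sphPoint r θ φ :=
    continuous_sphPoint continuous_id continuous_const continuous_const
  have hf'c : Continuous f' := by
    have := fun k => (continuous_partialD hw k).comp hcurve
    simp only [Function.comp_def] at this
    have h0 := this 0
    have h1 := this 1
    have h2 := this 2
    fun_prop
  have hz : ∀ r, R < |r| → w (sphPoint r θ φ) = 0 := fun r hr => h0 _ (by rwa [norm_sphPoint])
  have hcs : HasCompactSupport f' := by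
    refine HasCompactSupport.intro (isCompact_Icc (a := -R) (b := R)) fun r hr => ?_
    have hr' : R < |r| := by
      by_contra! h
      exact hr (abs_le.1 h)
    have hd := hasDerivAt_comp_sphPoint_radius hwd r θ φ
    have he : (fun t => w (sphPoint t θ φ)) =ᶠ[nhds r] fun _ => 0 := by
      filter_upwards [(isOpen_lt continuous_const continuous_abs).mem_nhds hr'] with t ht
      exact hz t ht
    exact hd.unique ((hasDerivAt_const r (0 : ℝ)).congr_of_eventuallyEq he)
  have hftc := integral_Ioi_of_hasDerivAt_of_tendsto' (a := 0)
    (fun r _ => hasDerivAt_comp_sphPoint_radius hwd r θ φ)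
    (hf'c.integrable_of_hasCompactSupport hcs).integrableOn
    (m := 0) (tendsto_const_nhds.congr' (by
      filter_upwards [Filter.eventually_gt_atTop R, Filter.eventually_gt_atTop 0] with t ht ht0
      rw [hz t (by rwa [abs_of_pos ht0])]))
  have hS0 : sphPoint 0 θ φ = 0 := by
    rw [← norm_eq_zero, norm_sphPoint, abs_zero]
  rw [hS0, zero_sub] at hftc
  -- x·∇ is r ∂_r, so |x|⁻³ and the volume factor r² leave exactly ∂_r w times the angular factor.
  rw [integral_radialMeasure, ← hftc, ← integral_mul_const]
  refine setIntegral_congr_fun measurableSet_Ioi fun r hr => ?_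
  have hr : 0 < r := hr
  simp only [Fin.sum_univ_three, norm_sphPoint, abs_of_pos hr, hκ r hr, sphPoint_zero_apply,
    sphPoint_one_apply, sphPoint_two_apply]
  field_simp

/-! ### Invariance under rotations -/

theorem integral_radial_mul_rotation_zero_one {w : E3 → ℝ} (hw : ContDiff ℝ ∞ w) {η : ℝ → ℝ}
    (hint : Integrable fun x : E3 =>
      η ‖x‖ * (x 0 * partialD 1 w x - x 1 * partialD 0 w x)) :
    ∫ x : E3, η ‖x‖ * (x 0 * partialD 1 w x - x 1 * partialD 0 w x) = 0 := by
  have hwd := hw.differentiable (by simp)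
  rw [← integral_comp_sphPoint hint, integral_prod _ (integrable_comp_sphPoint hint)]
  refine integral_eq_zero_of_ae (Filter.Eventually.of_forall fun r => ?_)
  simp only [Pi.zero_apply, norm_sphPoint]
  rw [integral_const_mul]
  refine mul_eq_zero_of_right _ ?_
  have hc : ∀ k, Continuous fun p : ℝ × ℝ => partialD k w (sphPoint r p.1 p.2) := fun k =>
    (continuous_partialD hw k).comp
      (continuous_sphPoint continuous_const continuous_fst continuous_snd)
  have h0 := hc 0
  have h1 := hc 1
  have hcc : Continuous fun p : ℝ × ℝ => sphPoint r p.1 p.2 0 * partialD 1 w (sphPoint r p.1 p.2)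
      - sphPoint r p.1 p.2 1 * partialD 0 w (sphPoint r p.1 p.2) := by
    simp only [sphPoint_zero_apply, sphPoint_one_apply]
    fun_prop
  rw [integral_angular hcc]
  refine (intervalIntegral.integral_congr (g := fun _ => 0) fun θ _ => ?_).trans (by simp)
  refine mul_eq_zero_of_right _ ?_
  -- x₀D₁ − x₁D₀ is the derivative in the azimuth, so it integrates to zero over a full circle.
  have hd : ∀ φ, HasDerivAt (fun t => w (sphPoint r θ t))
      (sphPoint r θ φ 0 * partialD 1 w (sphPoint r θ φ)
        - sphPoint r θ φ 1 * partialD 0 w (sphPoint r θ φ)) φ := fun φ => by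
    refine (hasDerivAt_comp_sphPoint_azimuth hwd r θ φ).congr_deriv ?_
    simp only [sphPoint_zero_apply, sphPoint_one_apply]
    ring
  rw [intervalIntegral.integral_eq_sub_of_hasDerivAt (fun φ _ => hd φ)
    ((hcc.comp (by fun_prop : Continuous fun φ : ℝ => (θ, φ))).intervalIntegrable _ _)]
  simp [sphPoint]

/-- Infinitesimal rotations `x_i D_j - x_j D_i` integrate to zero against radial weights. -/
theorem integral_radial_mul_rotation {w : E3 → ℝ} (hw : ContDiff ℝ ∞ w) {η : ℝ → ℝ}
    (i j : Fin 3) (hint : Integrable fun x : E3 =>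
      η ‖x‖ * (x i * partialD j w x - x j * partialD i w x)) :
    ∫ x : E3, η ‖x‖ * (x i * partialD j w x - x j * partialD i w x) = 0 := by
  by_cases hij : i = j
  · subst hij
    simp
  have hex : ∀ i j : Fin 3, i ≠ j → ∃ σ : Equiv.Perm (Fin 3), σ 0 = i ∧ σ 1 = j := by decide
  -- A permutation of the coordinates is an isometry, which reduces any pair of axes to the pair (0,
  -- 1).
  obtain ⟨σ, rfl, rfl⟩ := hex i j hij
  let P : E3 ≃ₗᵢ[ℝ] E3 := LinearIsometryEquiv.piLpCongrLeft 2 ℝ ℝ σ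
  have hPc : ∀ x : E3, ∀ k, P x (σ k) = x k := fun x k => by
    simp [P, LinearIsometryEquiv.piLpCongrLeft_apply]
  have hP1 : ∀ k, P (EuclideanSpace.single k 1) = EuclideanSpace.single (σ k) 1 := fun k => by
    simp [P]
  have hPd : ∀ k x, partialD k (fun y => w (P y)) x = partialD (σ k) w (P x) := fun k x => by
    have hd := ((hw.differentiable (by simp) (P x)).hasFDerivAt.comp x
      P.toContinuousLinearEquiv.hasFDerivAt).fderiv
    unfold partialD
    rw [← hP1]
    exact congrArg (fun L => L (EuclideanSpace.single k 1)) hd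
  have hPn : ∀ x, ‖P x‖ = ‖x‖ := P.norm_map
  have hmp : MeasurePreserving P := P.measurePreserving
  have hemb : MeasurableEmbedding P := P.toHomeomorph.measurableEmbedding
  have e : ∀ x, η ‖P x‖ * (P x (σ 0) * partialD (σ 1) w (P x)
      - P x (σ 1) * partialD (σ 0) w (P x)) = η ‖x‖ * (x 0 * partialD 1 (fun y => w (P y)) x
        - x 1 * partialD 0 (fun y => w (P y)) x) := fun x => by
    rw [hPn, hPc, hPc, hPd, hPd]
  rw [← hmp.integral_comp hemb]
  simp_rw [e]
  refine integral_radial_mul_rotation_zero_one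
    (hw.comp P.toContinuousLinearEquiv.contDiff) ?_
  have := (hmp.integrable_comp_emb hemb).2 hint
  simp only [Function.comp_def, e] at this
  exact this

/-! ### A weighted Poincaré inequality -/

/-- The mean of `w` over the equator of the sphere of radius `r`. -/
noncomputable def equatorMean (w : E3 → ℝ) (r : ℝ) : ℝ :=
  (∫ φ in (-Real.pi)..Real.pi, w (sphPoint r (Real.pi / 2) φ)) / (2 * Real.pi)

theorem continuous_equatorMean {w : E3 → ℝ} (hw : Continuous w) : Continuous (equatorMean w) := by
  unfold equatorMean
  refine Continuous.div_const ?_ _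
  refine intervalIntegral.continuous_parametric_intervalIntegral_of_continuous' ?_ _ _
  exact hw.comp (continuous_sphPoint continuous_fst continuous_const continuous_snd)

/-- The θ- and φ-derivatives are r times derivatives along orthonormal tangent vectors, the second
with an extra factor sin θ of modulus at most 1. So fφ² + 2fθ² is at most twice the tangential
energy. -/
theorem integral_sphere_poincare {w : E3 → ℝ} (hw : ContDiff ℝ ∞ w) (r : ℝ) :
    ∫ p : ℝ × ℝ, (w (sphPoint r p.1 p.2) - equatorMean w r) ^ 2
        ∂(polarMeasure.prod azimuthMeasure)
      ≤ ∫ p : ℝ × ℝ, 2 * (r ^ 2 * (∑ k : Fin 3, partialD k w (sphPoint r p.1 p.2) ^ 2)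
        - (∑ k : Fin 3, sphPoint r p.1 p.2 k * partialD k w (sphPoint r p.1 p.2)) ^ 2)
        ∂(polarMeasure.prod azimuthMeasure) := by
  have hwd := hw.differentiable (by simp)
  have hS : Continuous fun p : ℝ × ℝ => sphPoint r p.1 p.2 :=
    continuous_sphPoint continuous_const continuous_fst continuous_snd
  have hc : ∀ k, Continuous fun p : ℝ × ℝ => partialD k w (sphPoint r p.1 p.2) := fun k =>
    (continuous_partialD hw k).comp hS
  have h0 := hc 0
  have h1 := hc 1
  have h2 := hc 2
  refine (integral_angular_poincare (f := fun p => w (sphPoint r p.1 p.2)) (hw.continuous.comp hS)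
    (fθ := fun p => r * (Real.cos p.1 * Real.cos p.2) * partialD 0 w (sphPoint r p.1 p.2)
        + r * (Real.cos p.1 * Real.sin p.2) * partialD 1 w (sphPoint r p.1 p.2)
        + r * (-Real.sin p.1) * partialD 2 w (sphPoint r p.1 p.2))
    (fφ := fun p => r * (Real.sin p.1 * -Real.sin p.2) * partialD 0 w (sphPoint r p.1 p.2)
        + r * (Real.sin p.1 * Real.cos p.2) * partialD 1 w (sphPoint r p.1 p.2)
        + 0 * partialD 2 w (sphPoint r p.1 p.2))
    (fun θ φ => hasDerivAt_comp_sphPoint_polar hwd r θ φ)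
    (fun θ φ => hasDerivAt_comp_sphPoint_azimuth hwd r θ φ) (by fun_prop) (by fun_prop)
    (fun θ => by simp [sphPoint])).trans ?_
  refine integral_mono (integrable_angular (by fun_prop)) (integrable_angular ?_) fun p => ?_
  · simp only [Fin.sum_univ_three, sphPoint_zero_apply, sphPoint_one_apply, sphPoint_two_apply]
    fun_prop
  · simp only [Fin.sum_univ_three, sphPoint_zero_apply, sphPoint_one_apply, sphPoint_two_apply]
    set a := partialD 0 w (sphPoint r p.1 p.2)
    set b := partialD 1 w (sphPoint r p.1 p.2)
    set c := partialD 2 w (sphPoint r p.1 p.2)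
    have t1 := Real.sin_sq_add_cos_sq p.1
    have t2 := Real.sin_sq_add_cos_sq p.2
    set s := Real.sin p.1
    set s' := Real.sin p.2
    set d := Real.cos p.1
    set d' := Real.cos p.2
    have e : r ^ 2 * (a ^ 2 + b ^ 2 + c ^ 2) - (r * (s * d') * a + r * (s * s') * b
        + r * d * c) ^ 2 = r ^ 2 * (-s' * a + d' * b) ^ 2
          + (r * (d * d') * a + r * (d * s') * b + r * -s * c) ^ 2 := by
      have hd : d ^ 2 = 1 - s ^ 2 := by linarith
      have hd' : d' ^ 2 = 1 - s' ^ 2 := by linarith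
      ring_nf
      simp only [hd, hd']
      ring
    rw [e]
    have h3 : s ^ 2 ≤ 1 := by nlinarith [sq_nonneg d]
    have h4 : s ^ 2 * (r * (-s' * a + d' * b)) ^ 2 ≤ 1 * (r * (-s' * a + d' * b)) ^ 2 := by
      gcongr
    nlinarith [sq_nonneg (r * (-s' * a + d' * b))]

theorem integrable_tangential {w : E3 → ℝ} (hw : ContDiff ℝ ∞ w) (hs : HasCompactSupport w) :
    Integrable fun x : E3 => ‖x‖⁻¹ ^ 3 * (‖x‖ ^ 2 * (∑ k : Fin 3, partialD k w x ^ 2)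
        - (∑ k : Fin 3, x k * partialD k w x) ^ 2) := by
  have hc := continuous_partialD hw
  have h : ∀ k l : Fin 3, Integrable fun x : E3 => (partialD k w x * partialD l w x) *
      (‖x‖⁻¹ ^ 3 * ((if k = l then ‖x‖ ^ 2 else 0) - x k * x l)) := fun k l => by
    refine integrable_mul_of_le_inv_norm ((hc k).mul (hc l))
      ((hasCompactSupport_partialD hs k).mul_right) ?_ (by norm_num : 1 ≤ 2) (C := 2)
      fun x hx => ?_
    · by_cases hkl : k = l <;> simp only [hkl, if_true, if_false] <;> fun_prop
    · have hx' : 0 < ‖x‖ := norm_pos_iff.2 hx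
      rw [abs_mul, abs_of_nonneg (by positivity : 0 ≤ ‖x‖⁻¹ ^ 3)]
      have h1 : |(if k = l then ‖x‖ ^ 2 else 0) - x k * x l| ≤ 2 * ‖x‖ ^ 2 := by
        refine (abs_sub _ _).trans ?_
        have : |x k * x l| ≤ ‖x‖ * ‖x‖ := by
          rw [abs_mul]
          exact mul_le_mul (abs_apply_le_norm x k) (abs_apply_le_norm x l) (abs_nonneg _)
            hx'.le
        have h2 : |if k = l then ‖x‖ ^ 2 else 0| ≤ ‖x‖ ^ 2 := by
          split_ifs
          · rw [abs_of_nonneg (by positivity)]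
          · simp
        nlinarith
      calc _ ≤ ‖x‖⁻¹ ^ 3 * (2 * ‖x‖ ^ 2) := by gcongr
        _ = 2 * ‖x‖⁻¹ ^ 1 := by field_simp
  refine (integrable_finsetSum Finset.univ fun k _ =>
    integrable_finsetSum Finset.univ fun l _ => h k l).congr ?_
  refine Filter.Eventually.of_forall fun x => ?_
  simp [Fin.sum_univ_three]
  ring

/-- Lower integrals require no integrability of the left side; that is deduced afterwards from this
very bound. -/
theorem lintegral_poincare {w : E3 → ℝ} (hw : ContDiff ℝ ∞ w) :
    ∫⁻ x : E3, ENNReal.ofReal (‖x‖⁻¹ ^ 3 * (w x - equatorMean w ‖x‖) ^ 2)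
      ≤ ∫⁻ x : E3, ENNReal.ofReal (2 * (‖x‖⁻¹ ^ 3 *
        (‖x‖ ^ 2 * (∑ k : Fin 3, partialD k w x ^ 2)
          - (∑ k : Fin 3, x k * partialD k w x) ^ 2))) := by
  have hc := fun k => (continuous_partialD hw k).measurable
  have hm1 : Measurable fun x : E3 =>
      ENNReal.ofReal (‖x‖⁻¹ ^ 3 * (w x - equatorMean w ‖x‖) ^ 2) := by
    have := hw.continuous.measurable
    have := (continuous_equatorMean hw.continuous).measurable
    fun_prop
  have hm2 : Measurable fun x : E3 => ENNReal.ofReal (2 * (‖x‖⁻¹ ^ 3 *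
        (‖x‖ ^ 2 * (∑ k : Fin 3, partialD k w x ^ 2)
          - (∑ k : Fin 3, x k * partialD k w x) ^ 2))) := by
    fun_prop
  have hS := measurePreserving_sphPoint
  have e1 := lintegral_prod (μ := radialMeasure) (ν := polarMeasure.prod azimuthMeasure) _
    (hm1.comp hS.measurable).aemeasurable
  have e2 := lintegral_prod (μ := radialMeasure) (ν := polarMeasure.prod azimuthMeasure) _
    (hm2.comp hS.measurable).aemeasurable
  simp only [Function.comp_def] at e1 e2
  rw [← hS.lintegral_comp hm1, ← hS.lintegral_comp hm2, e1, e2]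
  refine lintegral_mono_ae ?_
  filter_upwards [ae_radialMeasure_mem] with r hr
  have hr : 0 < r := hr
  have hS : Continuous fun p : ℝ × ℝ => sphPoint r p.1 p.2 :=
    continuous_sphPoint continuous_const continuous_fst continuous_snd
  have hcS : ∀ k, Continuous fun p : ℝ × ℝ => partialD k w (sphPoint r p.1 p.2) := fun k =>
    (continuous_partialD hw k).comp hS
  have h0 := hcS 0
  have h1 := hcS 1
  have h2 := hcS 2
  have hwS := hw.continuous.comp hS
  simp only [Function.comp_def] at hwS
  have hc1 : Continuous fun p : ℝ × ℝ => r⁻¹ ^ 3 *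
      (w (sphPoint r p.1 p.2) - equatorMean w r) ^ 2 := by fun_prop
  have hc2 : Continuous fun p : ℝ × ℝ => 2 * (r⁻¹ ^ 3 *
      (r ^ 2 * (∑ k : Fin 3, partialD k w (sphPoint r p.1 p.2) ^ 2)
        - (∑ k : Fin 3, sphPoint r p.1 p.2 k * partialD k w (sphPoint r p.1 p.2)) ^ 2)) := by
    simp only [Fin.sum_univ_three, sphPoint_zero_apply, sphPoint_one_apply, sphPoint_two_apply]
    fun_prop
  simp only [norm_sphPoint, abs_of_pos hr]
  rw [← ofReal_integral_eq_lintegral_ofReal (integrable_angular hc1)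
      (Filter.Eventually.of_forall fun p => by positivity),
    ← ofReal_integral_eq_lintegral_ofReal (integrable_angular hc2)
      (Filter.Eventually.of_forall fun p => ?_)]
  · refine ENNReal.ofReal_le_ofReal ?_
    simp_rw [mul_left_comm (2 : ℝ)]
    rw [integral_const_mul, integral_const_mul]
    exact mul_le_mul_of_nonneg_left (integral_sphere_poincare hw r) (by positivity)
  · have h3 : (∑ k : Fin 3, sphPoint r p.1 p.2 k * partialD k w (sphPoint r p.1 p.2)) ^ 2
        ≤ (∑ k : Fin 3, sphPoint r p.1 p.2 k ^ 2)
          * ∑ k : Fin 3, partialD k w (sphPoint r p.1 p.2) ^ 2 :=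
      Finset.sum_mul_sq_le_sq_mul_sq _ _ _
    rw [← EuclideanSpace.real_norm_sq_eq, norm_sphPoint, sq_abs] at h3
    have : 0 ≤ r ^ 2 * (∑ k : Fin 3, partialD k w (sphPoint r p.1 p.2) ^ 2)
        - (∑ k : Fin 3, sphPoint r p.1 p.2 k * partialD k w (sphPoint r p.1 p.2)) ^ 2 := by
      linarith
    simp only [Pi.zero_apply]
    positivity

/-- The deviation of `w` from its equatorial mean is controlled by its tangential derivatives. -/
theorem integral_poincare {w : E3 → ℝ} (hw : ContDiff ℝ ∞ w) (hs : HasCompactSupport w) :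
    Integrable (fun x : E3 => ‖x‖⁻¹ ^ 3 * (w x - equatorMean w ‖x‖) ^ 2) ∧
    ∫ x : E3, ‖x‖⁻¹ ^ 3 * (w x - equatorMean w ‖x‖) ^ 2
      ≤ 2 * ∫ x : E3, ‖x‖⁻¹ ^ 3 * (‖x‖ ^ 2 * (∑ k : Fin 3, partialD k w x ^ 2)
          - (∑ k : Fin 3, x k * partialD k w x) ^ 2) := by
  have hm1 : Measurable fun x : E3 => ‖x‖⁻¹ ^ 3 * (w x - equatorMean w ‖x‖) ^ 2 := by
    have := hw.continuous.measurable
    have := (continuous_equatorMean hw.continuous).measurable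
    fun_prop
  have hle := lintegral_poincare hw
  have hint := (integrable_tangential hw hs).const_mul 2
  have hnn : ∀ x : E3, 0 ≤ ‖x‖⁻¹ ^ 3 * (w x - equatorMean w ‖x‖) ^ 2 := fun x => by positivity
  have hnn2 : ∀ x : E3, 0 ≤ 2 * (‖x‖⁻¹ ^ 3 * (‖x‖ ^ 2 * (∑ k : Fin 3, partialD k w x ^ 2)
          - (∑ k : Fin 3, x k * partialD k w x) ^ 2)) := fun x => by
    have h3 : (∑ k : Fin 3, x k * partialD k w x) ^ 2
        ≤ (∑ k : Fin 3, x k ^ 2) * ∑ k : Fin 3, partialD k w x ^ 2 :=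
      Finset.sum_mul_sq_le_sq_mul_sq _ _ _
    rw [← EuclideanSpace.real_norm_sq_eq] at h3
    have : 0 ≤ ‖x‖ ^ 2 * (∑ k : Fin 3, partialD k w x ^ 2)
          - (∑ k : Fin 3, x k * partialD k w x) ^ 2 := by linarith
    positivity
  rw [← ofReal_integral_eq_lintegral_ofReal hint (Filter.Eventually.of_forall hnn2)] at hle
  have hi : Integrable (fun x : E3 => ‖x‖⁻¹ ^ 3 * (w x - equatorMean w ‖x‖) ^ 2) :=
    ⟨hm1.aestronglyMeasurable, by
      rw [hasFiniteIntegral_iff_ofReal (Filter.Eventually.of_forall hnn)]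
      exact hle.trans_lt ENNReal.ofReal_lt_top⟩
  refine ⟨hi, ?_⟩
  rw [← ofReal_integral_eq_lintegral_ofReal hi (Filter.Eventually.of_forall hnn),
    ENNReal.ofReal_le_ofReal_iff (integral_nonneg hnn2), integral_const_mul] at hle
  exact hle

/-! ### Calculus of integrable functions with known integral -/

/-- `F` is integrable with integral `v`. -/
def HasIntegralEq (F : E3 → ℝ) (v : ℝ) : Prop := Integrable F ∧ ∫ x, F x = v

theorem HasIntegralEq.add {F G : E3 → ℝ} {v w : ℝ} (hF : HasIntegralEq F v)
    (hG : HasIntegralEq G w) : HasIntegralEq (fun x => F x + G x) (v + w) :=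
  ⟨hF.1.add hG.1, by rw [integral_add hF.1 hG.1, hF.2, hG.2]⟩

theorem HasIntegralEq.const_mul {F : E3 → ℝ} {v : ℝ} (hF : HasIntegralEq F v) (c : ℝ) :
    HasIntegralEq (fun x => c * F x) (c * v) :=
  ⟨hF.1.const_mul c, by rw [integral_const_mul, hF.2]⟩

theorem HasIntegralEq.sum {F : Fin 3 → E3 → ℝ} {v : Fin 3 → ℝ}
    (hF : ∀ i, HasIntegralEq (F i) (v i)) : HasIntegralEq (fun x => ∑ i, F i x) (∑ i, v i) :=
  ⟨integrable_finsetSum _ fun i _ => (hF i).1, by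
    rw [integral_finsetSum _ fun i _ => (hF i).1]
    exact Finset.sum_congr rfl fun i _ => (hF i).2⟩

theorem HasIntegralEq.congr {F G : E3 → ℝ} {v : ℝ} (hF : HasIntegralEq F v)
    (h : ∀ x, x ≠ 0 → F x = G x) : HasIntegralEq G v := by
  have hae : F =ᵐ[volume] G := by
    filter_upwards [Measure.ae_ne volume (0 : E3)] with x hx using h x hx
  exact ⟨hF.1.congr hae, by rw [← integral_congr_ae hae, hF.2]⟩

/-! ### The kernel `|x|⁻¹ (δ_ij + β ω_i ω_j)` -/

/-- The fundamental matrix up to a constant factor, as a function of `x` and `ρ = |x|⁻¹`. -/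
def kernelEntry (β : ℝ) (i j : Fin 3) (x : Fin 3 → ℝ) (ρ : ℝ) : ℝ :=
  (if i = j then 1 else 0) * ρ + β * (x i * x j * ρ ^ 3)

/-- The derivative of `kernelEntry` in the direction `k`. -/
def kernelEntryDeriv (β : ℝ) (k i j : Fin 3) (x : Fin 3 → ℝ) (ρ : ℝ) : ℝ :=
  (if i = j then 1 else 0) * -(x k * ρ ^ 3)
    + β * (((if i = k then 1 else 0) * x j + (if j = k then 1 else 0) * x i) * ρ ^ 3
      - 3 * (x i * x j * x k) * ρ ^ 5)

theorem hasLineDerivAt_kernelEntry (β : ℝ) (k i j : Fin 3) {x : E3} (hx : x ≠ 0) :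
    HasLineDerivAt ℝ (fun y : E3 => kernelEntry β i j y ‖y‖⁻¹)
      (kernelEntryDeriv β k i j x ‖x‖⁻¹) x (EuclideanSpace.single k 1) := by
  have hρ := hasLineDerivAt_inv_norm hx k
  have h3 := hρ.fun_mul (hρ.fun_mul hρ)
  have hij := (hasLineDerivAt_coord i k x).fun_mul (hasLineDerivAt_coord j k x)
  have hc : ∀ c : ℝ, HasLineDerivAt ℝ (fun _ : E3 => c) 0 x (EuclideanSpace.single k (1 : ℝ)) :=
    fun c => hasDerivAt_const _ c
  have h := ((hc (if i = j then 1 else 0)).fun_mul hρ).fun_add ((hc β).fun_mul (hij.fun_mul h3))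
  have e : (fun y : E3 => kernelEntry β i j y ‖y‖⁻¹) = fun y : E3 =>
      (if i = j then (1 : ℝ) else 0) * ‖y‖⁻¹
        + β * (y i * y j * (‖y‖⁻¹ * (‖y‖⁻¹ * ‖y‖⁻¹))) := by
    ext y
    unfold kernelEntry
    ring
  rw [e]
  refine HasDerivAt.congr_deriv h ?_
  unfold kernelEntryDeriv
  ring

theorem abs_delta_le (i j : Fin 3) : |if i = j then (1 : ℝ) else 0| ≤ 1 := by
  split_ifs <;> simp

theorem abs_kernelEntry_le (β : ℝ) (i j : Fin 3) {x : E3} (hx : x ≠ 0) :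
    |kernelEntry β i j x ‖x‖⁻¹| ≤ (1 + |β|) * ‖x‖⁻¹ ^ 1 := by
  have hx' : 0 < ‖x‖ := norm_pos_iff.2 hx
  unfold kernelEntry
  refine (abs_add_le _ _).trans ?_
  simp only [abs_mul, abs_pow, abs_inv, abs_norm]
  calc _ ≤ 1 * ‖x‖⁻¹ + |β| * (‖x‖ * ‖x‖ * ‖x‖⁻¹ ^ 3) := by
        gcongr
        · exact abs_delta_le i j
        · exact abs_apply_le_norm x i
        · exact abs_apply_le_norm x j
    _ = _ := by field_simp

theorem abs_kernelEntryDeriv_le (β : ℝ) (k i j : Fin 3) {x : E3} (hx : x ≠ 0) :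
    |kernelEntryDeriv β k i j x ‖x‖⁻¹| ≤ (1 + |β| * 5) * ‖x‖⁻¹ ^ 2 := by
  have hx' : 0 < ‖x‖ := norm_pos_iff.2 hx
  unfold kernelEntryDeriv
  have hi := abs_apply_le_norm x i
  have hj := abs_apply_le_norm x j
  have hk := abs_apply_le_norm x k
  refine (abs_add_le _ _).trans ?_
  have h1 : |((if i = k then (1 : ℝ) else 0) * x j + (if j = k then 1 else 0) * x i) * ‖x‖⁻¹ ^ 3
      - 3 * (x i * x j * x k) * ‖x‖⁻¹ ^ 5| ≤ 5 * ‖x‖⁻¹ ^ 2 := by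
    refine (abs_sub _ _).trans ?_
    have h2 : |((if i = k then (1 : ℝ) else 0) * x j + (if j = k then 1 else 0) * x i)|
        ≤ 1 * ‖x‖ + 1 * ‖x‖ := by
      refine (abs_add_le _ _).trans ?_
      simp only [abs_mul]
      gcongr
      · exact abs_delta_le i k
      · exact abs_delta_le j k
    have h3 : |x i * x j * x k| ≤ ‖x‖ * ‖x‖ * ‖x‖ := by
      simp only [abs_mul]
      gcongr
    rw [abs_mul _ (‖x‖⁻¹ ^ 3), abs_mul _ (‖x‖⁻¹ ^ 5), abs_mul 3]
    simp only [abs_pow, abs_inv, abs_norm]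
    rw [abs_of_pos (by norm_num : (0 : ℝ) < 3)]
    calc _ ≤ (1 * ‖x‖ + 1 * ‖x‖) * ‖x‖⁻¹ ^ 3 + 3 * (‖x‖ * ‖x‖ * ‖x‖) * ‖x‖⁻¹ ^ 5 := by gcongr
      _ = 5 * ‖x‖⁻¹ ^ 2 := by field_simp; norm_num
  rw [abs_mul β]
  have h4 : |(if i = j then (1 : ℝ) else 0) * -(x k * ‖x‖⁻¹ ^ 3)| ≤ ‖x‖⁻¹ ^ 2 := by
    simp only [abs_mul, abs_neg, abs_pow, abs_inv, abs_norm]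
    calc _ ≤ 1 * (‖x‖ * ‖x‖⁻¹ ^ 3) := by
          gcongr
          exact abs_delta_le i j
      _ = ‖x‖⁻¹ ^ 2 := by field_simp
  calc _ ≤ ‖x‖⁻¹ ^ 2 + |β| * (5 * ‖x‖⁻¹ ^ 2) := by gcongr
    _ = _ := by ring

theorem measurable_kernelEntry (β : ℝ) (i j : Fin 3) :
    Measurable fun x : E3 => kernelEntry β i j x ‖x‖⁻¹ := by
  unfold kernelEntry
  fun_prop

theorem measurable_kernelEntryDeriv (β : ℝ) (k i j : Fin 3) :
    Measurable fun x : E3 => kernelEntryDeriv β k i j x ‖x‖⁻¹ := by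
  unfold kernelEntryDeriv
  fun_prop

theorem integrable_mul_kernelEntry (β : ℝ) (i j : Fin 3) {g : E3 → ℝ} (hg : Continuous g)
    (hs : HasCompactSupport g) : Integrable fun x => g x * kernelEntry β i j x ‖x‖⁻¹ :=
  integrable_mul_of_le_inv_norm hg hs (measurable_kernelEntry β i j) one_le_two
    fun _ hx => abs_kernelEntry_le β i j hx

theorem hasIntegralEq_kernel_parts (β : ℝ) (k i j : Fin 3) {g : E3 → ℝ} (hg : ContDiff ℝ ∞ g)
    (hs : HasCompactSupport g) :
    HasIntegralEq (fun x => partialD k g x * kernelEntry β i j x ‖x‖⁻¹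
      + g x * kernelEntryDeriv β k i j x ‖x‖⁻¹) 0 := by
  have h1 := integrable_mul_kernelEntry β i j (continuous_partialD hg k)
    (hasCompactSupport_partialD hs k)
  have h2 := integrable_mul_of_le_inv_norm hg.continuous hs (measurable_kernelEntryDeriv β k i j)
    le_rfl fun _ hx => abs_kernelEntryDeriv_le β k i j hx
  obtain ⟨-, R, -, -, -, h0⟩ := exists_bound_and_radius hg.continuous hs
  refine ⟨h1.add h2, integral_eq_zero_of_hasLineDerivAt k
    (G := fun x => g x * kernelEntry β i j x ‖x‖⁻¹) (fun x hx => ?_) (R := R)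
    (fun x hx => by rw [h0 x hx, zero_mul]) (h1.add h2)⟩
  exact (hasLineDerivAt_partialD hg k x).fun_mul (hasLineDerivAt_kernelEntry β k i j hx)

/-- The divergence of a kernel column. Multiplied by α, its factor β − 1 becomes −2β for the
fundamental matrix. -/
theorem sum_kernelEntryDeriv (β : ℝ) (j : Fin 3) {x : E3} (hx : x ≠ 0) :
    ∑ k : Fin 3, kernelEntryDeriv β k k j x ‖x‖⁻¹ = (β - 1) * (x j * ‖x‖⁻¹ ^ 3) := by
  have hx' : 0 < ‖x‖ := norm_pos_iff.2 hx
  have h : (x 0 ^ 2 + x 1 ^ 2 + x 2 ^ 2) * ‖x‖⁻¹ ^ 2 = 1 := by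
    rw [← norm_sq_e3]
    field_simp
  unfold kernelEntryDeriv
  fin_cases j <;> simp [Fin.sum_univ_three] <;>
    simp only [← inv_pow]
  · linear_combination (-3 * β * x 0 * ‖x‖⁻¹ ^ 3) * h
  · linear_combination (-3 * β * x 1 * ‖x‖⁻¹ ^ 3) * h
  · linear_combination (-3 * β * x 2 * ‖x‖⁻¹ ^ 3) * h

/-! ### Moments of the sphere -/

theorem integral_angular_mul (a b : ℝ → ℝ) :
    ∫ p : ℝ × ℝ, a p.1 * b p.2 ∂(polarMeasure.prod azimuthMeasure)
      = (∫ θ in (0)..Real.pi, Real.sin θ * a θ) * ∫ φ in (-Real.pi)..Real.pi, b φ := by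
  rw [integral_prod_mul, integral_polarMeasure, integral_azimuthMeasure]

theorem integral_sin_zero_pi : ∫ θ in (0)..Real.pi, Real.sin θ = 2 := by
  rw [integral_sin]
  norm_num

theorem integral_sin_mul_sin_sq_zero_pi :
    ∫ θ in (0)..Real.pi, Real.sin θ * Real.sin θ ^ 2 = 4 / 3 := by
  have h := integral_sin_pow (n := 1) (a := 0) (b := Real.pi)
  simp only [pow_one] at h
  rw [integral_sin] at h
  simp_rw [← pow_succ']
  norm_num at h ⊢

theorem integral_sin_mul_cos_sq_zero_pi :
    ∫ θ in (0)..Real.pi, Real.sin θ * Real.cos θ ^ 2 = 2 / 3 := by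
  have e : ∀ θ, Real.sin θ * Real.cos θ ^ 2 = Real.sin θ - Real.sin θ * Real.sin θ ^ 2 :=
    fun θ => by linear_combination Real.sin θ * Real.sin_sq_add_cos_sq θ
  simp_rw [e]
  rw [intervalIntegral.integral_sub (by simp)
    ((by fun_prop : Continuous _).intervalIntegrable _ _), integral_sin_mul_sin_sq_zero_pi,
    integral_sin_zero_pi]
  norm_num

theorem integral_cos_sq_azimuth : ∫ φ in (-Real.pi)..Real.pi, Real.cos φ ^ 2 = Real.pi := by
  rw [integral_cos_sq]
  simp

theorem integral_sin_sq_azimuth : ∫ φ in (-Real.pi)..Real.pi, Real.sin φ ^ 2 = Real.pi := by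
  rw [integral_sin_sq]
  simp

theorem integral_sphPoint_mul (i j : Fin 3) :
    ∫ p : ℝ × ℝ, sphPoint 1 p.1 p.2 i * sphPoint 1 p.1 p.2 j
        ∂(polarMeasure.prod azimuthMeasure)
      = if i = j then 4 * Real.pi / 3 else 0 := by
  have hodd : ∀ h : ℝ → ℝ, (∀ x, h (-x) = -h x) → ∫ φ in (-Real.pi)..Real.pi, h φ = 0 := by
    intro h hh
    have := intervalIntegral.integral_comp_neg (a := -Real.pi) (b := Real.pi) h
    simp only [hh, neg_neg, intervalIntegral.integral_neg] at this
    linarith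
  have hcos : ∫ φ in (-Real.pi)..Real.pi, Real.cos φ = 0 := by simp
  have hsin : ∫ φ in (-Real.pi)..Real.pi, Real.sin φ = 0 := hodd _ Real.sin_neg
  have hsc : ∫ φ in (-Real.pi)..Real.pi, Real.sin φ * Real.cos φ = 0 :=
    hodd _ fun x => by rw [Real.sin_neg, Real.cos_neg, neg_mul]
  have key : ∀ {F : ℝ × ℝ → ℝ} {a b : ℝ → ℝ} {v : ℝ},
      (∀ p, F p = a p.1 * b p.2) →
      (∫ θ in (0)..Real.pi, Real.sin θ * a θ) * ∫ φ in (-Real.pi)..Real.pi, b φ = v →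
      ∫ p, F p ∂(polarMeasure.prod azimuthMeasure) = v := fun {F a b v} h hv => by
    simp_rw [h]
    rw [integral_angular_mul, hv]
  have hss := integral_sin_mul_sin_sq_zero_pi
  have hsc2 := integral_sin_mul_cos_sq_zero_pi
  fin_cases i <;> fin_cases j <;>
    simp only [Fin.zero_eta, Fin.mk_one, Fin.reduceFinMk, sphPoint_zero_apply,
      sphPoint_one_apply, sphPoint_two_apply, one_mul]
  · exact key (a := fun θ => Real.sin θ ^ 2) (b := fun φ => Real.cos φ ^ 2)
      (fun p => by ring) (by rw [hss, integral_cos_sq_azimuth]; simp; ring)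
  · exact key (a := fun θ => Real.sin θ ^ 2) (b := fun φ => Real.sin φ * Real.cos φ)
      (fun p => by ring) (by rw [hsc]; simp)
  · exact key (a := fun θ => Real.sin θ * Real.cos θ) (b := fun φ => Real.cos φ)
      (fun p => by ring) (by rw [hcos]; simp)
  · exact key (a := fun θ => Real.sin θ ^ 2) (b := fun φ => Real.sin φ * Real.cos φ)
      (fun p => by ring) (by rw [hsc]; simp)
  · exact key (a := fun θ => Real.sin θ ^ 2) (b := fun φ => Real.sin φ ^ 2)
      (fun p => by ring) (by rw [hss, integral_sin_sq_azimuth]; simp; ring)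
  · exact key (a := fun θ => Real.sin θ * Real.cos θ) (b := fun φ => Real.sin φ)
      (fun p => by ring) (by rw [hsin]; simp)
  · exact key (a := fun θ => Real.sin θ * Real.cos θ) (b := fun φ => Real.cos φ)
      (fun p => by ring) (by rw [hcos]; simp)
  · exact key (a := fun θ => Real.sin θ * Real.cos θ) (b := fun φ => Real.sin φ)
      (fun p => by ring) (by rw [hsin]; simp)
  · exact key (a := fun θ => Real.cos θ ^ 2) (b := fun φ => 1)
      (fun p => by ring) (by rw [hsc2]; simp; ring)

/-- Since ω_i ω_j has integral 4πδ_ij/3 over the sphere, the kernel δ_ij + 3β ω_i ω_j has integral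
4π(1 + β)δ_ij. -/
theorem hasIntegralEq_euler_kernel (β : ℝ) (i j : Fin 3) {w : E3 → ℝ} (hw : ContDiff ℝ ∞ w)
    (hs : HasCompactSupport w) :
    HasIntegralEq (fun x => ‖x‖⁻¹ ^ 3 * (∑ k : Fin 3, x k * partialD k w x)
      * ((if i = j then 1 else 0) + 3 * β * (‖x‖⁻¹ ^ 2 * x i * x j)))
      (-w 0 * (if i = j then 4 * Real.pi * (1 + β) else 0)) := by
  have hK : Measurable fun x : E3 => (if i = j then (1 : ℝ) else 0)
      + 3 * β * (‖x‖⁻¹ ^ 2 * x i * x j) := by fun_prop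
  have hC : ∀ x : E3, |(if i = j then (1 : ℝ) else 0) + 3 * β * (‖x‖⁻¹ ^ 2 * x i * x j)|
      ≤ 1 + 3 * |β| * 1 := fun x => by
    refine (abs_add_le _ _).trans ?_
    have h1 : |‖x‖⁻¹ ^ 2 * x i * x j| ≤ 1 := by
      simp only [abs_mul, abs_pow, abs_inv, abs_norm]
      have : ‖x‖⁻¹ ^ 2 * |x i| * |x j| ≤ ‖x‖⁻¹ ^ 2 * ‖x‖ * ‖x‖ := by
        gcongr
        · exact abs_apply_le_norm x i
        · exact abs_apply_le_norm x j
      refine this.trans ?_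
      rcases eq_or_ne x 0 with rfl | hx
      · simp
      · have hx' : 0 < ‖x‖ := norm_pos_iff.2 hx
        apply le_of_eq
        field_simp
    rw [abs_mul (3 * β), abs_mul 3, abs_of_pos (by norm_num : (0 : ℝ) < 3)]
    gcongr
    exact abs_delta_le i j
  refine ⟨integrable_inv_norm_cube_mul_euler hw hs hK hC, ?_⟩
  have hsc : ∀ (r θ φ : ℝ) (l : Fin 3), sphPoint r θ φ l = r * sphPoint 1 θ φ l := fun r θ φ l => by
    fin_cases l <;> simp
  have hcS : ∀ l, Continuous fun p : ℝ × ℝ => sphPoint 1 p.1 p.2 l := fun l => by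
    have := continuous_sphPoint (continuous_const (y := (1 : ℝ))) continuous_fst continuous_snd
      (X := ℝ × ℝ)
    fun_prop
  rw [integral_inv_norm_cube_mul_euler hw hs hK hC (κ := fun p => (if i = j then (1 : ℝ) else 0)
      + 3 * β * (sphPoint 1 p.1 p.2 i * sphPoint 1 p.1 p.2 j))]
  · congr 1
    have h1 := hcS i
    have h2 := hcS j
    rw [integral_add (integrable_angular (by fun_prop)) (integrable_angular (by fun_prop)),
      integral_const_mul, integral_sphPoint_mul]
    have h3 := integral_angular_mul (fun _ => 1) fun _ => 1
    simp only [mul_one, integral_sin_zero_pi, intervalIntegral.integral_const, smul_eq_mul] at h3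
    split_ifs
    · rw [h3]
      ring
    · simp
  · intro r hr θ φ
    rw [norm_sphPoint, abs_of_pos hr, hsc r θ φ i, hsc r θ φ j]
    field_simp

/-! ### Algebraic identities for the integrand -/

/-- The first-order quadratic form with the coefficients `kernelEntry`; `P k i` stands for
`D_k u_i`. -/
def gradientForm (α β : ℝ) (P : Fin 3 → Fin 3 → ℝ) (x : Fin 3 → ℝ) (ρ : ℝ) : ℝ :=
  (∑ k, ∑ i, ∑ j, P k i * P k j * kernelEntry β i j x ρ)
    + α * ∑ k, ∑ j, (∑ l, P l l) * P k j * kernelEntry β k j x ρ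

/-- The form `ρ³ v_i (x_i D_j - x_j D_i) u_j`; `P k i` stands for `D_k u_i`. -/
def rotationForm (P : Fin 3 → Fin 3 → ℝ) (v x : Fin 3 → ℝ) (ρ : ℝ) : ℝ :=
  ∑ i, ∑ j, ρ ^ 3 * v i * (x i * P j j - x j * P i j)

/-- The product rule as algebra: `H k i` stands for D_kk u_i, `d` for grad div u, `P k i` for D_k
u_i, `W` for the kernel and `v` for u. -/
theorem second_order_form_eq (α : ℝ) (H : Fin 3 → Fin 3 → ℝ) (d : Fin 3 → ℝ)
    (P W : Fin 3 → Fin 3 → ℝ) (v : Fin 3 → ℝ) :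
    ∑ i, ∑ j, (-(∑ k, H k i) - α * d i) * W i j * v j
      = -(∑ k, ∑ i, ∑ j, (H k i * v j + P k i * P k j) * W i j)
        - α * (∑ k, ∑ j, (d k * v j + (∑ l, P l l) * P k j) * W k j)
        + ((∑ k, ∑ i, ∑ j, P k i * P k j * W i j)
          + α * ∑ k, ∑ j, (∑ l, P l l) * P k j * W k j) := by
  simp only [Fin.sum_univ_three]
  ring

/-- The parts of the kernel derivative proportional to x_k are symmetric in i, j and give half the
Euler derivative of v_i v_j. The rest is β(div u (x·v) + x_i v_k D_k u_i) ρ³, and subtracting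
exactly 2β div u (x·v) ρ³ makes it antisymmetric: a combination of rotations. -/
theorem sum_kernelEntryDeriv_mul (β : ℝ) (P : Fin 3 → Fin 3 → ℝ) (v x : Fin 3 → ℝ) (ρ : ℝ) :
    (∑ k, ∑ i, ∑ j, P k i * v j * kernelEntryDeriv β k i j x ρ)
        - 2 * β * ∑ j, (∑ l, P l l) * v j * (x j * ρ ^ 3)
      = -(1 / 2) * (∑ i, ∑ j, ρ ^ 3 * (∑ k, x k * (P k i * v j + v i * P k j))
          * ((if i = j then 1 else 0) + 3 * β * (ρ ^ 2 * x i * x j)))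
        - β * rotationForm P v x ρ := by
  unfold kernelEntryDeriv rotationForm
  simp [Fin.sum_univ_three]
  ring

theorem rotationForm_sub (P : Fin 3 → Fin 3 → ℝ) (v m x : Fin 3 → ℝ) (ρ : ℝ) :
    rotationForm P v x ρ = rotationForm P (fun i => v i - m i) x ρ + rotationForm P m x ρ := by
  unfold rotationForm
  simp only [Fin.sum_univ_three]
  ring

/-! ### The energy identity -/

section Energy

variable {f : Fin 3 → E3 → ℝ}

theorem contDiff_sum_partialD (hf : ∀ i, ContDiff ℝ ∞ (f i)) :
    ContDiff ℝ ∞ fun x => ∑ k : Fin 3, partialD k (f k) x :=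
  ContDiff.sum fun k _ => contDiff_partialD (hf k) k

theorem hasCompactSupport_sum_partialD (hs : ∀ i, HasCompactSupport (f i)) :
    HasCompactSupport fun x => ∑ k : Fin 3, partialD k (f k) x := by
  simp only [Fin.sum_univ_three]
  exact ((hasCompactSupport_partialD (hs 0) 0).add (hasCompactSupport_partialD (hs 1) 1)).add
    (hasCompactSupport_partialD (hs 2) 2)

theorem abs_equatorMean_le {w : E3 → ℝ} {C : ℝ} (hC : ∀ x, |w x| ≤ C) (r : ℝ) :
    |equatorMean w r| ≤ C := by
  have hpi := Real.pi_pos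
  have h := intervalIntegral.norm_integral_le_of_norm_le_const (a := -Real.pi) (b := Real.pi)
    (f := fun φ => w (sphPoint r (Real.pi / 2) φ)) (C := C) fun φ _ => hC _
  unfold equatorMean
  rw [abs_div, abs_of_pos (by positivity : 0 < 2 * Real.pi), div_le_iff₀ (by positivity)]
  rw [abs_of_pos (by linarith), Real.norm_eq_abs] at h
  linarith

theorem integrable_mul_coord {g K : E3 → ℝ} (hg : Continuous g) (hs : HasCompactSupport g)
    (hK : Measurable K) {C : ℝ} (hC : ∀ x, |K x| ≤ C) (i : Fin 3) :
    Integrable fun x => g x * (‖x‖⁻¹ ^ 3 * K x * x i) := by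
  refine integrable_mul_of_le_inv_norm hg hs (by fun_prop) le_rfl (C := C) fun x hx => ?_
  have hx' : 0 < ‖x‖ := norm_pos_iff.2 hx
  simp only [abs_mul, abs_pow, abs_inv, abs_norm]
  calc ‖x‖⁻¹ ^ 3 * |K x| * |x i| ≤ ‖x‖⁻¹ ^ 3 * C * ‖x‖ := by
        have := (abs_nonneg _).trans (hC x)
        gcongr
        · exact hC x
        · exact abs_apply_le_norm x i
    _ = C * ‖x‖⁻¹ ^ 2 := by field_simp

/-- Each equatorial mean depends on |x| only, so it is a radial weight for the rotation fields. -/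
theorem hasIntegralEq_rotationForm_equatorMean (hf : ∀ i, ContDiff ℝ ∞ (f i))
    (hs : ∀ i, HasCompactSupport (f i)) :
    HasIntegralEq (fun x => rotationForm (fun k i => partialD k (f i) x)
      (fun i => equatorMean (f i) ‖x‖) x ‖x‖⁻¹) 0 := by
  have h : ∀ i j, HasIntegralEq (fun x : E3 => ‖x‖⁻¹ ^ 3 * equatorMean (f i) ‖x‖ *
      (x i * partialD j (f j) x - x j * partialD i (f j) x)) 0 := fun i j => by
    obtain ⟨C, hC⟩ := (hs i).exists_bound_of_continuous (hf i).continuous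
    have hm : Measurable fun x : E3 => equatorMean (f i) ‖x‖ :=
      ((continuous_equatorMean (hf i).continuous).comp continuous_norm).measurable
    have hi : Integrable fun x : E3 => ‖x‖⁻¹ ^ 3 * equatorMean (f i) ‖x‖ *
      (x i * partialD j (f j) x - x j * partialD i (f j) x) := by
      have hC' : ∀ x : E3, |equatorMean (f i) ‖x‖| ≤ C := fun x => abs_equatorMean_le hC _
      refine ((integrable_mul_coord (continuous_partialD (hf j) j)
        (hasCompactSupport_partialD (hs j) j) hm hC' i).sub
        (integrable_mul_coord (continuous_partialD (hf j) i)
        (hasCompactSupport_partialD (hs j) i) hm hC' j)).congr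
          (Filter.Eventually.of_forall fun x => ?_)
      simp only [Pi.sub_apply]
      ring
    exact ⟨hi, integral_radial_mul_rotation (hf j) (η := fun r => r⁻¹ ^ 3 * equatorMean (f i) r)
      i j hi⟩
  have := HasIntegralEq.sum fun i => HasIntegralEq.sum (h i)
  simpa [rotationForm] using this

/-- The energy identity: up to terms that integrate to zero, the weighted Lamé form is a point
evaluation at the origin plus a quadratic form in the gradient and in the deviation from the
spherical averages. -/
theorem hasIntegralEq_energy {α β : ℝ} (hαβ : α * (β - 1) = -2 * β)
    (hf : ∀ i, ContDiff ℝ ∞ (f i)) (hs : ∀ i, HasCompactSupport (f i)) :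
    HasIntegralEq (fun x => (∑ i, ∑ j, (-(∑ k, partialD k (partialD k (f i)) x)
        - α * partialD i (fun y => ∑ l : Fin 3, partialD l (f l) y) x)
          * kernelEntry β i j x ‖x‖⁻¹ * f j x)
      - (gradientForm α β (fun k i => partialD k (f i) x) x ‖x‖⁻¹
        - β * rotationForm (fun k i => partialD k (f i) x)
          (fun i => f i x - equatorMean (f i) ‖x‖) x ‖x‖⁻¹))
      (2 * Real.pi * (1 + β) * ∑ i, f i 0 ^ 2) := by
  set dv : E3 → ℝ := fun y => ∑ l : Fin 3, partialD l (f l) y with hdv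
  have hdvc : ContDiff ℝ ∞ dv := contDiff_sum_partialD hf
  have hdvs : HasCompactSupport dv := hasCompactSupport_sum_partialD hs
  have h1 := HasIntegralEq.sum fun k => HasIntegralEq.sum fun i => HasIntegralEq.sum fun j =>
    hasIntegralEq_kernel_parts β k i j ((contDiff_partialD (hf i) k).mul (hf j))
      ((hs j).mul_left (f := partialD k (f i)))
  have h2 := HasIntegralEq.sum fun k => HasIntegralEq.sum fun j =>
    hasIntegralEq_kernel_parts β k k j (hdvc.mul (hf j)) ((hs j).mul_left (f := dv))
  have h3 := HasIntegralEq.sum fun i => HasIntegralEq.sum fun j =>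
    hasIntegralEq_euler_kernel β i j ((hf i).mul (hf j)) ((hs j).mul_left (f := f i))
  have h4 := hasIntegralEq_rotationForm_equatorMean hf hs
  -- The factors −1, −α, −1/2, −β are those with which the four integrals enter the pointwise
  -- identity that closes the proof.
  have h := ((h1.const_mul (-1)).add (h2.const_mul (-α))).add
    ((h3.const_mul (-(1 / 2))).add (h4.const_mul (-β)))
  have hv : -1 * (∑ k : Fin 3, ∑ i : Fin 3, ∑ j : Fin 3, (0 : ℝ))
      + -α * (∑ k : Fin 3, ∑ j : Fin 3, (0 : ℝ))
      + (-(1 / 2) * (∑ i, ∑ j, -(f i 0 * f j 0) * (if i = j then 4 * Real.pi * (1 + β) else 0))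
        + -β * 0) = 2 * Real.pi * (1 + β) * ∑ i, f i 0 ^ 2 := by
    simp [Fin.sum_univ_three]
    ring
  have h' : HasIntegralEq _ (2 * Real.pi * (1 + β) * ∑ i, f i 0 ^ 2) := hv ▸ h
  refine h'.congr fun x hx => ?_
  simp only [partialD_mul (hf _) (hf _), partialD_mul (contDiff_partialD (hf _) _) (hf _),
    partialD_mul hdvc (hf _)]
  have e1 := second_order_form_eq α (fun k i => partialD k (partialD k (f i)) x)
    (fun i => partialD i dv x) (fun k i => partialD k (f i) x)
    (fun i j => kernelEntry β i j x ‖x‖⁻¹) (fun j => f j x)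
  have e2 := sum_kernelEntryDeriv_mul β (fun k i => partialD k (f i) x) (fun j => f j x) x ‖x‖⁻¹
  have e3 := rotationForm_sub (fun k i => partialD k (f i) x) (fun j => f j x)
    (fun i => equatorMean (f i) ‖x‖) x ‖x‖⁻¹
  -- The only use of the relation between α and β.
  have e4 : α * ∑ k, ∑ j, dv x * f j x * kernelEntryDeriv β k k j x ‖x‖⁻¹
      = -(2 * β * ∑ j, dv x * f j x * (x j * ‖x‖⁻¹ ^ 3)) := by
    rw [Finset.sum_comm, Finset.mul_sum, Finset.mul_sum, ← Finset.sum_neg_distrib]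
    refine Finset.sum_congr rfl fun j _ => ?_
    rw [← Finset.mul_sum, sum_kernelEntryDeriv β j hx]
    linear_combination (dv x * f j x * (x j * ‖x‖⁻¹ ^ 3)) * hαβ
  simp only at e1 e2 e3
  rw [e1]
  unfold gradientForm
  simp only [Finset.sum_add_distrib, add_mul]
  simp only [Finset.sum_add_distrib, add_mul] at e1 e2 e3 e4 ⊢
  have hd : ∑ l : Fin 3, partialD l (f l) x = dv x := rfl
  simp only [hd] at e1 e2 e3 e4 ⊢
  linear_combination -e4 - e2 + β * e3

end Energy

/-! ### Coercivity of the first-order form -/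

/-- A and B stand for the squared radial and tangential parts of the gradient, s for the radial
derivative of the radial component, τ for the trace of the tangential part, and G for the tangential
derivatives of u in the direction ω. The term 2|β|B is reserved for the rotation form. -/
theorem scalar_coercivity {α β A B G s τ : ℝ} (h : (0 ≤ α ∧ 0 ≤ β ∧ β ≤ 9 / 20 ∧ α * β ≤ 4) ∨
      (-(39 / 200) ≤ α ∧ α ≤ 0 ∧ -(11 / 100) ≤ β ∧ β ≤ 0))
    (hs : s ^ 2 ≤ A) (hG0 : 0 ≤ G) (hG : G ≤ B) (hτ : τ ^ 2 ≤ 2 * B) :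
    2 * |β| * B + 1 / 10 * (A + B)
      ≤ A + B + β * (s ^ 2 + G) + α * (s + τ) ^ 2 + α * β * ((s + τ) * s) := by
  rcases h with ⟨hα, hβ, hβ1, hαβ⟩ | ⟨hα, hα0, hβ, hβ0⟩
  · rw [abs_of_nonneg hβ]
    -- Completing the square in s + τ costs αβ²s²/4, which βs² absorbs when αβ ≤ 4. The bound 9/20
    -- is 2β + 1/10 ≤ 1.
    have h1 : 0 ≤ α * (s + τ + β * s / 2) ^ 2 := by positivity
    have h2 : 0 ≤ β * s ^ 2 * (4 - α * β) := mul_nonneg (by positivity) (by linarith)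
    have h3 : 0 ≤ (9 / 20 - β) * B := mul_nonneg (by linarith) (hG0.trans hG)
    nlinarith [mul_nonneg hβ hG0, sq_nonneg s]
  · rw [abs_of_nonpos hβ0]
    have hB : 0 ≤ B := hG0.trans hG
    have hA : 0 ≤ A := (sq_nonneg s).trans hs
    have h1 : -(11 / 100) * (A + B) ≤ β * (s ^ 2 + G) := by
      nlinarith [mul_nonneg (by linarith : 0 ≤ -β) (by linarith : 0 ≤ A + B - (s ^ 2 + G)),
        mul_nonneg (by linarith : 0 ≤ β + 11 / 100) (by linarith : 0 ≤ A + B)]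
    -- The weights favour B, which must also pay 2|β|B: A keeps 1 − 0.11 − 4·0.195 = 0.11, just
    -- above the required 1/10.
    have h2 : (s + τ) ^ 2 ≤ 4 * A + 8 / 3 * B := by
      nlinarith [sq_nonneg (3 * s - τ)]
    have h3 : -(39 / 200) * (4 * A + 8 / 3 * B) ≤ α * (s + τ) ^ 2 := by
      nlinarith [mul_nonneg (by linarith : 0 ≤ -α)
          (by linarith : 0 ≤ 4 * A + 8 / 3 * B - (s + τ) ^ 2),
        mul_nonneg (by linarith : 0 ≤ α + 39 / 200) (by positivity : 0 ≤ 4 * A + 8 / 3 * B)]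
    have h4 : -(B / 2) ≤ (s + τ) * s := by nlinarith [sq_nonneg (2 * s + τ)]
    have hαβ : 0 ≤ α * β := mul_nonneg_of_nonpos_of_nonpos hα0 hβ0
    have hαβ1 : α * β ≤ 39 / 200 * (11 / 100) := by
      nlinarith
    have h5 : -(39 / 200 * (11 / 100) * (B / 2)) ≤ α * β * ((s + τ) * s) := by
      nlinarith [mul_nonneg hαβ (by linarith : 0 ≤ (s + τ) * s + B / 2),
        mul_nonneg (by linarith : 0 ≤ 39 / 200 * (11 / 100) - α * β) hB]
    nlinarith

/-- With o = ω, P splits as T + o ⊗ p, where p is the radial derivative and T is orthogonal to o in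
its derivative index. This reduces the claim to `scalar_coercivity`. -/
theorem matrix_coercivity {α β : ℝ} (h : (0 ≤ α ∧ 0 ≤ β ∧ β ≤ 9 / 20 ∧ α * β ≤ 4) ∨
      (-(39 / 200) ≤ α ∧ α ≤ 0 ∧ -(11 / 100) ≤ β ∧ β ≤ 0)) (P : Fin 3 → Fin 3 → ℝ)
    {o : Fin 3 → ℝ} (ho : ∑ i, o i ^ 2 = 1) :
    2 * |β| * ((∑ k, ∑ i, P k i ^ 2) - ∑ i, (∑ k, o k * P k i) ^ 2)
        + 1 / 10 * ∑ k, ∑ i, P k i ^ 2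
      ≤ (∑ k, ∑ i, P k i ^ 2) + β * ∑ k, (∑ i, o i * P k i) ^ 2 + α * (∑ l, P l l) ^ 2
        + α * β * ((∑ l, P l l) * ∑ k, ∑ j, o k * o j * P k j) := by
  set p : Fin 3 → ℝ := fun i => ∑ k, o k * P k i with hp
  set T : Fin 3 → Fin 3 → ℝ := fun k i => P k i - o k * p i with hT
  have hP : ∀ k i, P k i = T k i + o k * p i := fun k i => by simp [hT]
  have hoT : ∀ i, ∑ k, o k * T k i = 0 := fun i => by
    simp only [hT, mul_sub, Finset.sum_sub_distrib]
    have e : ∑ k, o k * (o k * p i) = (∑ k, o k ^ 2) * p i := by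
      rw [Finset.sum_mul]
      exact Finset.sum_congr rfl fun k _ => by ring
    rw [e, ho, one_mul, sub_self]
  have h0 := hoT 0
  have h1 := hoT 1
  have h2 := hoT 2
  have hsum : ∑ k, ∑ i, P k i ^ 2 = (∑ i, p i ^ 2) + ∑ k, ∑ i, T k i ^ 2 := by
    simp only [hP]
    simp only [Fin.sum_univ_three] at ho h0 h1 h2 ⊢
    linear_combination (p 0 ^ 2 + p 1 ^ 2 + p 2 ^ 2) * ho + 2 * p 0 * h0 + 2 * p 1 * h1
      + 2 * p 2 * h2
  have hs : (∑ i, o i * p i) ^ 2 ≤ ∑ i, p i ^ 2 := by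
    have := Finset.sum_mul_sq_le_sq_mul_sq Finset.univ o p
    rwa [ho, one_mul] at this
  have hcol : ∑ k, (∑ i, o i * P k i) ^ 2
      = (∑ i, o i * p i) ^ 2 + ∑ k, (∑ i, o i * T k i) ^ 2 := by
    simp only [hP]
    simp only [Fin.sum_univ_three] at ho h0 h1 h2 ⊢
    linear_combination (o 0 * p 0 + o 1 * p 1 + o 2 * p 2) ^ 2 * ho
      + 2 * (o 0 * p 0 + o 1 * p 1 + o 2 * p 2) * (o 0 * h0 + o 1 * h1 + o 2 * h2)
  have htr : ∑ l, P l l = (∑ i, o i * p i) + ∑ l, T l l := by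
    rw [← Finset.sum_add_distrib]
    exact Finset.sum_congr rfl fun l _ => by rw [hP]; ring
  have hoo : ∑ k, ∑ j, o k * o j * P k j = ∑ i, o i * p i := by
    simp only [hp, Fin.sum_univ_three]
    ring
  have hG : ∑ k, (∑ i, o i * T k i) ^ 2 ≤ ∑ k, ∑ i, T k i ^ 2 := by
    refine Finset.sum_le_sum fun k _ => ?_
    have := Finset.sum_mul_sq_le_sq_mul_sq Finset.univ o (T k)
    rwa [ho, one_mul] at this
  -- Cauchy–Schwarz against the projection I − o ⊗ o, whose squared Frobenius norm is 2; pairing it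
  -- with T gives the trace because o annihilates T.
  have hτ : (∑ l, T l l) ^ 2 ≤ 2 * ∑ k, ∑ i, T k i ^ 2 := by
    have := Finset.sum_mul_sq_le_sq_mul_sq (Finset.univ : Finset (Fin 3 × Fin 3))
      (fun q => (if q.1 = q.2 then 1 else 0) - o q.1 * o q.2) fun q => T q.1 q.2
    simp only [Fintype.sum_prod_type] at this
    have e1 : ∑ k : Fin 3, ∑ i : Fin 3, ((if k = i then (1 : ℝ) else 0) - o k * o i) ^ 2 = 2 := by
      simp [Fin.sum_univ_three] at ho ⊢
      linear_combination (o 0 ^ 2 + o 1 ^ 2 + o 2 ^ 2 - 1) * ho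
    have e2 : ∑ k : Fin 3, ∑ i : Fin 3, ((if k = i then (1 : ℝ) else 0) - o k * o i) * T k i
        = ∑ l, T l l := by
      simp [Fin.sum_univ_three] at h0 h1 h2 ⊢
      linear_combination -(o 0 * h0 + o 1 * h1 + o 2 * h2)
    rwa [e1, e2] at this
  have key := scalar_coercivity h hs (Finset.sum_nonneg fun k _ => sq_nonneg _) hG hτ
  rw [hcol, htr, hoo, hsum]
  linarith

/-- The squared tangential part of a gradient, with weight `ρ³|x|²`. -/
def tangentialForm (P : Fin 3 → Fin 3 → ℝ) (x : Fin 3 → ℝ) (ρ R : ℝ) : ℝ :=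
  ∑ i, ρ ^ 3 * (R ^ 2 * (∑ k, P k i ^ 2) - (∑ k, x k * P k i) ^ 2)

theorem gradientForm_coercive {α β : ℝ} (h : (0 ≤ α ∧ 0 ≤ β ∧ β ≤ 9 / 20 ∧ α * β ≤ 4) ∨
      (-(39 / 200) ≤ α ∧ α ≤ 0 ∧ -(11 / 100) ≤ β ∧ β ≤ 0)) (P : Fin 3 → Fin 3 → ℝ)
    {x : E3} (hx : x ≠ 0) :
    2 * |β| * tangentialForm P x ‖x‖⁻¹ ‖x‖ + 1 / 10 * (‖x‖⁻¹ * ∑ k, ∑ i, P k i ^ 2)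
      ≤ gradientForm α β P x ‖x‖⁻¹ := by
  have hx' : 0 < ‖x‖ := norm_pos_iff.2 hx
  have hR : ‖x‖⁻¹ * ‖x‖ = 1 := by field_simp
  have ho : ∑ i, (x i * ‖x‖⁻¹) ^ 2 = 1 := by
    simp only [mul_pow]
    rw [← Finset.sum_mul, ← EuclideanSpace.real_norm_sq_eq]
    field_simp
  have key := mul_le_mul_of_nonneg_left (matrix_coercivity h P ho) (inv_pos.2 hx').le
  have e1 : tangentialForm P x ‖x‖⁻¹ ‖x‖ = ‖x‖⁻¹ * ((∑ k, ∑ i, P k i ^ 2)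
      - ∑ i, (∑ k, x k * ‖x‖⁻¹ * P k i) ^ 2) := by
    unfold tangentialForm
    set R := ‖x‖
    set ρ := R⁻¹
    simp only [Fin.sum_univ_three]
    linear_combination (ρ * R + 1) * ρ * (P 0 0 ^ 2 + P 0 1 ^ 2 + P 0 2 ^ 2 + P 1 0 ^ 2
      + P 1 1 ^ 2 + P 1 2 ^ 2 + P 2 0 ^ 2 + P 2 1 ^ 2 + P 2 2 ^ 2) * hR
  have e2 : gradientForm α β P x ‖x‖⁻¹ = ‖x‖⁻¹ * ((∑ k, ∑ i, P k i ^ 2)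
      + β * ∑ k, (∑ i, x i * ‖x‖⁻¹ * P k i) ^ 2 + α * (∑ l, P l l) ^ 2
        + α * β * ((∑ l, P l l) * ∑ k, ∑ j, x k * ‖x‖⁻¹ * (x j * ‖x‖⁻¹) * P k j)) := by
    unfold gradientForm kernelEntry
    simp [Fin.sum_univ_three]
    ring
  rw [e1, e2]
  linarith

/-- By Lagrange's identity the tangential form is the sum of the squares of the nine expressions x_k
D_l u_i − x_l D_k u_i, k < l, and each component of the rotation is, up to signs, a sum of two of
them. -/
theorem abs_rotationForm_le (P : Fin 3 → Fin 3 → ℝ) (v : Fin 3 → ℝ) (x : E3) :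
    |rotationForm P v x ‖x‖⁻¹| ≤ (∑ i, ‖x‖⁻¹ ^ 3 * v i ^ 2) / 2
      + tangentialForm P x ‖x‖⁻¹ ‖x‖ := by
  have hρ : 0 ≤ ‖x‖⁻¹ ^ 3 := by positivity
  have e1 : rotationForm P v x ‖x‖⁻¹
      = ‖x‖⁻¹ ^ 3 * ∑ i, v i * ∑ j, (x i * P j j - x j * P i j) := by
    unfold rotationForm
    simp only [Finset.mul_sum]
    exact Finset.sum_congr rfl fun i _ => Finset.sum_congr rfl fun j _ => by ring
  have e2 : tangentialForm P x ‖x‖⁻¹ ‖x‖ = ‖x‖⁻¹ ^ 3 * ∑ i, ((x 0 * P 1 i - x 1 * P 0 i) ^ 2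
      + (x 0 * P 2 i - x 2 * P 0 i) ^ 2 + (x 1 * P 2 i - x 2 * P 1 i) ^ 2) := by
    unfold tangentialForm
    rw [norm_sq_e3, Finset.mul_sum]
    refine Finset.sum_congr rfl fun i _ => ?_
    simp only [Fin.sum_univ_three]
    ring
  have e3 : (∑ i, ‖x‖⁻¹ ^ 3 * v i ^ 2) / 2 = ‖x‖⁻¹ ^ 3 * ((∑ i, v i ^ 2) / 2) := by
    rw [← Finset.mul_sum, mul_div_assoc]
  rw [e1, e2, e3, ← mul_add, abs_mul, abs_of_nonneg hρ]
  refine mul_le_mul_of_nonneg_left ?_ hρ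
  -- Here y is one of the three expressions that occur in no rotation component; adding y² completes
  -- the tangential form.
  have habs : ∀ v w y a b : ℝ, w = a + b → |v * w| ≤ v ^ 2 / 2 + (a ^ 2 + b ^ 2 + y ^ 2) := by
    rintro v w y a b rfl
    rw [abs_le]
    constructor <;> nlinarith [sq_nonneg (v + (a + b)), sq_nonneg (v - (a + b)),
      sq_nonneg (a - b), sq_nonneg y]
  have h0 := habs (v 0) (∑ j, (x 0 * P j j - x j * P 0 j)) (x 0 * P 1 2 - x 1 * P 0 2)
    (x 0 * P 1 1 - x 1 * P 0 1) (x 0 * P 2 2 - x 2 * P 0 2) (by simp [Fin.sum_univ_three]; ring)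
  have h1 := habs (v 1) (∑ j, (x 1 * P j j - x j * P 1 j)) (x 0 * P 2 1 - x 2 * P 0 1)
    (-(x 0 * P 1 0 - x 1 * P 0 0)) (x 1 * P 2 2 - x 2 * P 1 2) (by simp [Fin.sum_univ_three]; ring)
  have h2 := habs (v 2) (∑ j, (x 2 * P j j - x j * P 2 j)) (x 1 * P 2 0 - x 2 * P 1 0)
    (-(x 0 * P 2 0 - x 2 * P 0 0)) (-(x 1 * P 2 1 - x 2 * P 1 1))
    (by simp [Fin.sum_univ_three]; ring)
  rw [Fin.sum_univ_three (fun i => v i * _)]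
  refine (abs_add_three _ _ _).trans ((add_le_add (add_le_add h0 h1) h2).trans (le_of_eq ?_))
  simp only [Fin.sum_univ_three]
  ring

/-! ### Weighted positivity -/

theorem lameIntegrand_fundMatrix_eq (α : ℝ) (u : E3 → E3) (x : E3) :
    lameIntegrand α (fundMatrix α) u x = lameConst α *
      ∑ i, ∑ j, (-(∑ k, partialD k (partialD k (fun y => u y i)) x)
        - α * partialD i (fun y => ∑ l : Fin 3, partialD l (fun z => u z l) y) x)
          * kernelEntry (α / (α + 2)) i j x ‖x‖⁻¹ * u x j := by
  unfold lameIntegrand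
  simp only [Finset.mul_sum]
  refine Finset.sum_congr rfl fun i _ => Finset.sum_congr rfl fun j _ => ?_
  have e : lame α u i x = -(∑ k, partialD k (partialD k (fun y => u y i)) x)
        - α * partialD i (fun y => ∑ l : Fin 3, partialD l (fun z => u z l) y) x := rfl
  rw [← e]
  unfold fundMatrix kernelEntry
  simp only [div_eq_mul_inv]
  ring

section Positivity

variable {u : E3 → E3}

theorem contDiff_component (hu : ContDiff ℝ ∞ u) (i : Fin 3) : ContDiff ℝ ∞ fun y => u y i :=
  contDiff_euclidean.1 hu i

theorem hasCompactSupport_component (hs : HasCompactSupport u) (i : Fin 3) :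
    HasCompactSupport fun y => u y i :=
  hs.comp_left (g := fun v : E3 => v i) rfl

theorem integrable_lameIntegrand (α : ℝ) (hu : ContDiff ℝ ∞ u) (hs : HasCompactSupport u) :
    Integrable fun x => lameIntegrand α (fundMatrix α) u x := by
  simp_rw [lameIntegrand_fundMatrix_eq]
  refine Integrable.const_mul ?_ _
  refine integrable_finsetSum _ fun i _ => integrable_finsetSum _ fun j _ => ?_
  have hf := contDiff_component hu
  have hfs := hasCompactSupport_component hs
  have hc : Continuous fun x => (-(∑ k, partialD k (partialD k (fun y => u y i)) x)
        - α * partialD i (fun y => ∑ l : Fin 3, partialD l (fun z => u z l) y) x) * u x j := by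
    have h1 := fun k => continuous_partialD (contDiff_partialD (hf i) k) k
    have h2 := continuous_partialD (contDiff_sum_partialD hf) i
    have h3 := (hf j).continuous
    fun_prop
  refine (integrable_mul_kernelEntry (α / (α + 2)) i j hc ((hfs j).mul_left)).congr
    (Filter.Eventually.of_forall fun x => ?_)
  ring

theorem integrable_gradNormSq_div_norm (hu : ContDiff ℝ ∞ u) (hs : HasCompactSupport u) :
    Integrable fun x => gradNormSq u x / ‖x‖ := by
  have hf := contDiff_component hu
  have hfs := hasCompactSupport_component hs
  have h : ∀ i k, Integrable fun x : E3 =>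
      (partialD k (fun y => u y i) x * partialD k (fun y => u y i) x) * ‖x‖⁻¹ := fun i k =>
    integrable_mul_of_le_inv_norm
      ((continuous_partialD (hf i) k).mul (continuous_partialD (hf i) k))
      ((hasCompactSupport_partialD (hfs i) k).mul_left) (by fun_prop) one_le_two (C := 1)
      fun x _ => by simp
  refine (integrable_finsetSum Finset.univ fun i _ =>
    integrable_finsetSum Finset.univ fun k _ => h i k).congr
    (Filter.Eventually.of_forall fun x => ?_)
  simp only [gradNormSq, div_eq_mul_inv, Finset.sum_mul, sq]

/-- At the endpoints α/(α+2) is about −0.108 and 0.433, so the thresholds −0.11 and 0.45 leave some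
room. -/
theorem kernel_parameter_bounds {α : ℝ} (h1 : -0.195 < α) (h2 : α < 1.5245) :
    (0 ≤ α ∧ 0 ≤ α / (α + 2) ∧ α / (α + 2) ≤ 9 / 20 ∧ α * (α / (α + 2)) ≤ 4) ∨
      (-(39 / 200) ≤ α ∧ α ≤ 0 ∧ -(11 / 100) ≤ α / (α + 2) ∧ α / (α + 2) ≤ 0) := by
  have h3 : 0 < α + 2 := by linarith
  rcases le_total 0 α with h | h
  · have h4 : α / (α + 2) ≤ 9 / 20 := by
      rw [div_le_iff₀ h3]
      linarith
    refine Or.inl ⟨h, by positivity, h4, ?_⟩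
    nlinarith
  · refine Or.inr ⟨by linarith, h, ?_, div_nonpos_of_nonpos_of_nonneg h h3.le⟩
    rw [le_div_iff₀ h3]
    linarith

theorem lameConst_pos {α : ℝ} (h : -1 < α) : 0 < lameConst α := by
  have h1 : 0 < α + 1 := by linarith
  have h2 : 0 < α + 2 := by linarith
  have := Real.pi_pos
  unfold lameConst
  positivity

/-- The quantitative weighted positivity of the Lamé operator. -/
theorem lame_weighted_lower_bound {α : ℝ} (h1 : -0.195 < α) (h2 : α < 1.5245)
    (hu : ContDiff ℝ ∞ u) (hs : HasCompactSupport u) :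
    1 / 2 * ‖u 0‖ ^ 2 + lameConst α / 10 * ∫ x : E3, gradNormSq u x / ‖x‖
      ≤ ∫ x : E3, lameIntegrand α (fundMatrix α) u x := by
  have hf := contDiff_component hu
  have hfs := hasCompactSupport_component hs
  have hα2 : 0 < α + 2 := by linarith
  have hα1 : 0 < α + 1 := by linarith
  have hc := lameConst_pos (by linarith : -1 < α)
  have hpar := kernel_parameter_bounds h1 h2
  set β := α / (α + 2) with hβ
  have hαβ : α * (β - 1) = -2 * β := by
    rw [hβ]
    field_simp
    ring
  -- The normalisation of Φ makes the coefficient of |u(0)|² exactly 1/2.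
  have hcβ : lameConst α * (2 * Real.pi * (1 + β)) = 1 / 2 := by
    have := Real.pi_pos
    rw [hβ, lameConst]
    field_simp
    ring
  obtain ⟨hEi, hE⟩ := hasIntegralEq_energy hαβ hf hfs
  have hLi := integrable_lameIntegrand α hu hs
  have hGi := integrable_gradNormSq_div_norm hu hs
  have hP := fun i => integral_poincare (hf i) (hfs i)
  have hTi := fun i => integrable_tangential (hf i) (hfs i)
  set L : E3 → ℝ := fun x => ∑ i, ∑ j, (-(∑ k, partialD k (partialD k (fun y => u y i)) x)
        - α * partialD i (fun y => ∑ l : Fin 3, partialD l (fun z => u z l) y) x)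
          * kernelEntry β i j x ‖x‖⁻¹ * u x j with hL
  have hLeq : ∀ x, lameIntegrand α (fundMatrix α) u x = lameConst α * L x :=
    lameIntegrand_fundMatrix_eq α u
  have hLint : Integrable L := by
    refine (hLi.const_mul (lameConst α)⁻¹).congr (Filter.Eventually.of_forall fun x => ?_)
    simp only [hLeq]
    rw [inv_mul_cancel_left₀ hc.ne']
  set Q : E3 → ℝ := fun x => gradientForm α β (fun k i => partialD k (fun y => u y i) x) x ‖x‖⁻¹
        - β * rotationForm (fun k i => partialD k (fun y => u y i) x)
          (fun i => u x i - equatorMean (fun y => u y i) ‖x‖) x ‖x‖⁻¹ with hQ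
  have hQint : Integrable Q := by
    refine (hLint.sub hEi).congr (Filter.Eventually.of_forall fun x => ?_)
    simp only [Pi.sub_apply]
    exact sub_sub_cancel _ _
  -- A pointwise minorant of `Q`; its |β|-part has no pointwise sign, but its integral is
  -- nonnegative by the Poincaré inequality with constant 2.
  set D : E3 → ℝ := fun x => 1 / 10 * (gradNormSq u x / ‖x‖)
    + |β| * ∑ i : Fin 3, (‖x‖⁻¹ ^ 3 * (‖x‖ ^ 2 * (∑ k : Fin 3, partialD k (fun y => u y i) x ^ 2)
        - (∑ k : Fin 3, x k * partialD k (fun y => u y i) x) ^ 2)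
      - (‖x‖⁻¹ ^ 3 * (u x i - equatorMean (fun y => u y i) ‖x‖) ^ 2) / 2) with hD
  have hsumint : ∀ i : Fin 3, Integrable fun x : E3 => ‖x‖⁻¹ ^ 3 *
      (‖x‖ ^ 2 * (∑ k : Fin 3, partialD k (fun y => u y i) x ^ 2)
        - (∑ k : Fin 3, x k * partialD k (fun y => u y i) x) ^ 2)
      - (‖x‖⁻¹ ^ 3 * (u x i - equatorMean (fun y => u y i) ‖x‖) ^ 2) / 2 := fun i =>
    (hTi i).sub ((hP i).1.div_const 2)
  have hDint : Integrable D :=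
    (hGi.const_mul _).add ((integrable_finsetSum _ fun i _ => hsumint i).const_mul _)
  have hDQ : ∫ x, D x ≤ ∫ x, Q x := by
    refine integral_mono_ae hDint hQint ?_
    filter_upwards [Measure.ae_ne volume (0 : E3)] with x hx
    have g1 := gradientForm_coercive hpar (fun k i => partialD k (fun y => u y i) x) hx
    have g2 := abs_rotationForm_le (fun k i => partialD k (fun y => u y i) x)
      (fun i => u x i - equatorMean (fun y => u y i) ‖x‖) x
    have g3 : β * rotationForm (fun k i => partialD k (fun y => u y i) x)
          (fun i => u x i - equatorMean (fun y => u y i) ‖x‖) x ‖x‖⁻¹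
        ≤ |β| * ((∑ i, ‖x‖⁻¹ ^ 3 * (u x i - equatorMean (fun y => u y i) ‖x‖) ^ 2) / 2
          + tangentialForm (fun k i => partialD k (fun y => u y i) x) x ‖x‖⁻¹ ‖x‖) := by
      refine (le_abs_self _).trans ?_
      rw [abs_mul]
      exact mul_le_mul_of_nonneg_left g2 (abs_nonneg β)
    have g4 : gradNormSq u x / ‖x‖
        = ‖x‖⁻¹ * ∑ k, ∑ i, partialD k (fun y => u y i) x ^ 2 := by
      rw [gradNormSq, Finset.sum_comm, div_eq_inv_mul]
    simp only [hD, hQ, Finset.sum_sub_distrib, ← Finset.sum_div, g4]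
    have g5 : ∑ i : Fin 3, ‖x‖⁻¹ ^ 3 * (‖x‖ ^ 2 * (∑ k : Fin 3, partialD k (fun y => u y i) x ^ 2)
        - (∑ k : Fin 3, x k * partialD k (fun y => u y i) x) ^ 2)
        = tangentialForm (fun k i => partialD k (fun y => u y i) x) x ‖x‖⁻¹ ‖x‖ := rfl
    rw [g5]
    linarith
  have hDge : 1 / 10 * ∫ x : E3, gradNormSq u x / ‖x‖ ≤ ∫ x, D x := by
    simp only [hD]
    rw [integral_add (hGi.const_mul _) ((integrable_finsetSum _ fun i _ => hsumint i).const_mul _),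
      integral_const_mul, integral_const_mul, integral_finsetSum _ fun i _ => hsumint i]
    refine le_add_of_nonneg_right (mul_nonneg (abs_nonneg β) (Finset.sum_nonneg fun i _ => ?_))
    rw [integral_sub (hTi i) ((hP i).1.div_const 2), integral_div]
    linarith [(hP i).2]
  have hLQ : ∫ x, L x = 2 * Real.pi * (1 + β) * ∑ i, u 0 i ^ 2 + ∫ x, Q x := by
    rw [← hE, ← integral_add hEi hQint]
    refine integral_congr_ae (Filter.Eventually.of_forall fun x => ?_)
    exact (sub_add_cancel _ _).symm
  simp_rw [hLeq]
  rw [integral_const_mul, hLQ, ← EuclideanSpace.real_norm_sq_eq, mul_add, ← mul_assoc, hcβ]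
  have := mul_le_mul_of_nonneg_left (hDge.trans hDQ) hc.le
  linarith

end Positivity

/-! ### Failure of weighted positivity -/

theorem partialD_const_mul {f : E3 → ℝ} (hf : ContDiff ℝ ∞ f) (c : ℝ) (k : Fin 3) (x : E3) :
    partialD k (fun y => c * f y) x = c * partialD k f x := by
  unfold partialD
  rw [fderiv_const_mul (hf.differentiable (by simp) x)]
  rfl

theorem partialD_add {f g : E3 → ℝ} (hf : ContDiff ℝ ∞ f) (hg : ContDiff ℝ ∞ g) (k : Fin 3)
    (x : E3) : partialD k (fun y => f y + g y) x = partialD k f x + partialD k g x := by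
  unfold partialD
  rw [fderiv_fun_add (hf.differentiable (by simp) x) (hg.differentiable (by simp) x)]
  rfl

theorem lame_smul_const (α : ℝ) {f : E3 → ℝ} (hf : ContDiff ℝ ∞ f) (a : E3) (i : Fin 3) (x : E3) :
    lame α (fun y => f y • a) i x = -(∑ k, a i * partialD k (partialD k f) x)
      - α * ∑ k, a k * partialD i (partialD k f) x := by
  have h1 : ∀ i k : Fin 3, partialD k (fun y => (f y • a) i) = fun y => a i * partialD k f y :=
    fun i k => by
      ext y
      rw [← partialD_const_mul hf]
      congr 1
      ext z
      simp [mul_comm]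
  have h2 : ∀ k : Fin 3, ∀ c : ℝ, ContDiff ℝ ∞ fun y => c * partialD k f y := fun k c =>
    contDiff_const.mul (contDiff_partialD hf k)
  unfold lame divergence
  simp only [h1, partialD_const_mul (contDiff_partialD hf _), Fin.sum_univ_three]
  rw [partialD_add ((h2 0 _).add (h2 1 _)) (h2 2 _), partialD_add (h2 0 _) (h2 1 _)]
  simp only [partialD_const_mul (contDiff_partialD hf _)]

section Oscillation

variable {χ : E3 → ℝ} (ℓ : E3 →L[ℝ] ℝ)

theorem contDiff_cos_clm : ContDiff ℝ ∞ fun x => Real.cos (ℓ x) :=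
  Real.contDiff_cos.comp ℓ.contDiff

theorem contDiff_sin_clm : ContDiff ℝ ∞ fun x => Real.sin (ℓ x) :=
  Real.contDiff_sin.comp ℓ.contDiff

theorem partialD_cos_clm (k : Fin 3) (x : E3) :
    partialD k (fun y => Real.cos (ℓ y)) x
      = -ℓ (EuclideanSpace.single k 1) * Real.sin (ℓ x) := by
  unfold partialD
  rw [(ℓ.hasFDerivAt.cos).fderiv]
  simp
  ring

theorem partialD_sin_clm (k : Fin 3) (x : E3) :
    partialD k (fun y => Real.sin (ℓ y)) x
      = ℓ (EuclideanSpace.single k 1) * Real.cos (ℓ x) := by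
  unfold partialD
  rw [(ℓ.hasFDerivAt.sin).fderiv]
  simp
  ring

/-- Adding the cosine and sine parts cancels every term linear in ℓ, so only the quadratic term and
a term free of ℓ remain. -/
theorem second_partialD_oscillation (hχ : ContDiff ℝ ∞ χ) (k l : Fin 3) (x : E3) :
    partialD l (partialD k fun y => χ y * Real.cos (ℓ y)) x * (χ x * Real.cos (ℓ x))
      + partialD l (partialD k fun y => χ y * Real.sin (ℓ y)) x * (χ x * Real.sin (ℓ x))
      = partialD l (partialD k χ) x * χ x
        - ℓ (EuclideanSpace.single k 1) * ℓ (EuclideanSpace.single l 1) * χ x ^ 2 := by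
  have hC := contDiff_cos_clm ℓ
  have hS := contDiff_sin_clm ℓ
  have hχk := contDiff_partialD hχ k
  have e1 : partialD k (fun y => χ y * Real.cos (ℓ y)) = fun y =>
      partialD k χ y * Real.cos (ℓ y)
        + -ℓ (EuclideanSpace.single k 1) * (χ y * Real.sin (ℓ y)) := by
    ext y
    rw [partialD_mul hχ hC, partialD_cos_clm]
    ring
  have e2 : partialD k (fun y => χ y * Real.sin (ℓ y)) = fun y =>
      partialD k χ y * Real.sin (ℓ y)
        + ℓ (EuclideanSpace.single k 1) * (χ y * Real.cos (ℓ y)) := by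
    ext y
    rw [partialD_mul hχ hS, partialD_sin_clm]
    ring
  rw [e1, e2, partialD_add (hχk.mul hC) (contDiff_const.mul (hχ.mul hS)),
    partialD_add (hχk.mul hS) (contDiff_const.mul (hχ.mul hC)),
    partialD_const_mul (hχ.mul hS), partialD_const_mul (hχ.mul hC), partialD_mul hχk hC,
    partialD_mul hχk hS, partialD_mul hχ hC, partialD_mul hχ hS, partialD_cos_clm,
    partialD_sin_clm]
  linear_combination (partialD l (partialD k χ) x * χ x
        - ℓ (EuclideanSpace.single k 1) * ℓ (EuclideanSpace.single l 1) * χ x ^ 2)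
        * Real.sin_sq_add_cos_sq (ℓ x)

/-- The principal symbol of the weighted Lamé form in the direction `ξ`, evaluated at `a`. -/
def lameSymbol (α : ℝ) (Ψ : E3 → Matrix (Fin 3) (Fin 3) ℝ) (ξ : Fin 3 → ℝ) (a x : E3) : ℝ :=
  ∑ i, ∑ j, ((∑ k, ξ k ^ 2) * a i + α * (∑ k, ξ k * a k) * ξ i) * Ψ x i j * a j

theorem lameIntegrand_oscillation (α : ℝ) (Ψ : E3 → Matrix (Fin 3) (Fin 3) ℝ)
    (hχ : ContDiff ℝ ∞ χ) (a x : E3) :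
    lameIntegrand α Ψ (fun y => (χ y * Real.cos (ℓ y)) • a) x
      + lameIntegrand α Ψ (fun y => (χ y * Real.sin (ℓ y)) • a) x
      = χ x ^ 2 * lameSymbol α Ψ (fun k => ℓ (EuclideanSpace.single k 1)) a x
        + lameIntegrand α Ψ (fun y => χ y • a) x := by
  unfold lameIntegrand lameSymbol
  rw [← Finset.sum_add_distrib, Finset.mul_sum, ← Finset.sum_add_distrib]
  refine Finset.sum_congr rfl fun i _ => ?_
  rw [← Finset.sum_add_distrib, Finset.mul_sum, ← Finset.sum_add_distrib]
  refine Finset.sum_congr rfl fun j _ => ?_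
  rw [lame_smul_const α (hχ.mul (contDiff_cos_clm ℓ)),
    lame_smul_const α (hχ.mul (contDiff_sin_clm ℓ)), lame_smul_const α hχ]
  have h := fun k l => second_partialD_oscillation ℓ hχ k l x
  simp only [PiLp.smul_apply, smul_eq_mul, Fin.sum_univ_three]
  linear_combination (-(a i) * (h 0 0 + h 1 1 + h 2 2)
    - α * (a 0 * h 0 i + a 1 * h 1 i + a 2 * h 2 i)) * (Ψ x i j * a j)

end Oscillation

theorem lameSymbol_const_mul (α : ℝ) (Ψ : E3 → Matrix (Fin 3) (Fin 3) ℝ) (ξ : Fin 3 → ℝ) (N : ℝ)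
    (a x : E3) : lameSymbol α Ψ (fun k => N * ξ k) a x = N ^ 2 * lameSymbol α Ψ ξ a x := by
  simp only [lameSymbol, Fin.sum_univ_three]
  ring

theorem continuousAt_lameSymbol (α : ℝ) (ξ : Fin 3 → ℝ) (a : E3) {x : E3} (hx : x ≠ 0) :
    ContinuousAt (lameSymbol α (fundMatrix α) ξ a) x := by
  have hn : ‖x‖ ≠ 0 := norm_ne_zero_iff.2 hx
  unfold lameSymbol fundMatrix
  fun_prop (disch := assumption)

/-- If the principal symbol is negative at some point, then weighted positivity fails. -/
theorem not_posDefWithWeight_of_lameSymbol_neg {α : ℝ} {ξ : Fin 3 → ℝ} {a x₀ : E3} (hx₀ : x₀ ≠ 0)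
    (hneg : lameSymbol α (fundMatrix α) ξ a x₀ < 0) : ¬ PosDefWithWeight α (fundMatrix α) := by
  intro hpos
  have hev : ∀ᶠ x in nhds x₀, lameSymbol α (fundMatrix α) ξ a x < 0 ∧ x ≠ 0 :=
    ((continuousAt_lameSymbol α ξ a hx₀).eventually (Iio_mem_nhds hneg)).and
      (isOpen_ne.mem_nhds hx₀)
  obtain ⟨δ, hδ, hball⟩ := Metric.eventually_nhds_iff_ball.1 hev
  let χ : ContDiffBump x₀ := ⟨δ / 4, δ / 2, by positivity, by linarith⟩
  have hχ : ContDiff ℝ ∞ χ := χ.contDiff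
  have hχs : HasCompactSupport χ := χ.hasCompactSupport
  have hχt : tsupport χ ⊆ {(0 : E3)}ᶜ := by
    rw [χ.tsupport_eq]
    intro x hx
    exact (hball x (Metric.closedBall_subset_ball (by change δ / 2 < δ; linarith) hx)).2
  have hadm : ∀ h : E3 → ℝ, ContDiff ℝ ∞ h →
      ContDiff ℝ ∞ (fun y => (χ y * h y) • a) ∧ HasCompactSupport (fun y => (χ y * h y) • a) ∧
        tsupport (fun y => (χ y * h y) • a) ⊆ {(0 : E3)}ᶜ := fun h hh =>
    ⟨(hχ.mul hh).smul contDiff_const, (hχs.mul_right (f' := h)).smul_right (f' := fun _ => a),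
      ((tsupport_smul_subset_left (fun y => χ y * h y) fun _ => a).trans
        (tsupport_mul_subset_left (f := χ) (g := h))).trans hχt⟩
  have hbase : Integrable fun x => lameIntegrand α (fundMatrix α) (fun y => χ y • a) x :=
    integrable_lameIntegrand α (hχ.smul contDiff_const) (hχs.smul_right (f' := fun _ => a))
  set K := ∫ x, lameIntegrand α (fundMatrix α) (fun y => χ y • a) x with hK
  let ℓ : ℝ → E3 →L[ℝ] ℝ := fun N => innerSL ℝ (WithLp.toLp 2 fun k => N * ξ k : E3)
  have hℓ : ∀ N k, ℓ N (EuclideanSpace.single k 1) = N * ξ k := fun N k => by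
    simp [ℓ, EuclideanSpace.inner_single_right]
  have hid : ∀ N x, lameIntegrand α (fundMatrix α) (fun y => (χ y * Real.cos (ℓ N y)) • a) x
      + lameIntegrand α (fundMatrix α) (fun y => (χ y * Real.sin (ℓ N y)) • a) x
      = N ^ 2 * (χ x ^ 2 * lameSymbol α (fundMatrix α) ξ a x)
        + lameIntegrand α (fundMatrix α) (fun y => χ y • a) x := fun N x => by
    rw [lameIntegrand_oscillation (ℓ N) α (fundMatrix α) hχ a x]
    simp only [hℓ]
    rw [lameSymbol_const_mul]
    ring
  have hci := fun N => hadm _ (contDiff_cos_clm (ℓ N))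
  have hsi := fun N => hadm _ (contDiff_sin_clm (ℓ N))
  have hcI := fun N => integrable_lameIntegrand α (hci N).1 (hci N).2.1
  have hsI := fun N => integrable_lameIntegrand α (hsi N).1 (hsi N).2.1
  -- Integrability of χ² times the symbol is read off from the identity at N = 1.
  have hJint : Integrable fun x => χ x ^ 2 * lameSymbol α (fundMatrix α) ξ a x := by
    refine (((hcI 1).add (hsI 1)).sub hbase).congr (Filter.Eventually.of_forall fun x => ?_)
    simp only [Pi.add_apply, Pi.sub_apply]
    rw [hid 1 x]
    ring
  set J := ∫ x, χ x ^ 2 * lameSymbol α (fundMatrix α) ξ a x with hJ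
  have hJneg : J < 0 := by
    have hnn : ∀ x, 0 ≤ -(χ x ^ 2 * lameSymbol α (fundMatrix α) ξ a x) := fun x => by
      by_cases hx : x ∈ Metric.ball x₀ δ
      · have := (hball x hx).1
        have := mul_nonneg (sq_nonneg (χ x)) (neg_nonneg.2 this.le)
        linarith
      · have : χ x = 0 := χ.zero_of_le_dist (by
          have := not_lt.1 (fun h => hx (Metric.mem_ball.2 h))
          change δ / 2 ≤ _
          linarith)
        simp [this]
    have hpos : 0 < ∫ x, -(χ x ^ 2 * lameSymbol α (fundMatrix α) ξ a x) := by
      rw [integral_pos_iff_support_of_nonneg hnn hJint.neg]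
      refine (Metric.measure_ball_pos volume x₀ (by positivity : 0 < δ / 4)).trans_le
        (measure_mono fun x hx => ?_)
      have h1 : χ x = 1 := χ.one_of_mem_closedBall (Metric.ball_subset_closedBall hx)
      have h2 := (hball x (Metric.ball_subset_ball (by linarith) hx)).1
      simp [h1, h2.ne]
    rw [integral_neg] at hpos
    linarith
  have hall : ∀ N, 0 ≤ N ^ 2 * J + K := fun N => by
    have h1 := hpos _ (hci N).1 (hci N).2.1 (hci N).2.2
    have h2 := hpos _ (hsi N).1 (hsi N).2.1 (hsi N).2.2
    have h3 := integral_add (hcI N) (hsI N)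
    simp only [hid] at h3
    rw [integral_add (hJint.const_mul _) hbase, integral_const_mul, ← hJ, ← hK] at h3
    linarith
  -- With this N, N²J + K = K − |K| − 1 < 0.
  have h := hall √((|K| + 1) / -J)
  rw [Real.sq_sqrt (div_nonneg (by positivity) (by linarith))] at h
  have e : (|K| + 1) / -J * J = -(|K| + 1) := by
    rw [div_neg, neg_mul, div_mul_cancel₀ _ hJneg.ne]
  rw [e] at h
  linarith [le_abs_self K]

/-- At x₀ = e₀ with ξ = (1, 1, 0), the symbol on vectors (a₀, a₁, 0) is a positive multiple of
2(α+1)a₀² + α(3α+4)/(α+2) a₀a₁ + (α+2)a₁². The chosen a minimises it in a₁ for fixed a₀, and the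
hypothesis says that the discriminant is positive. -/
theorem not_posDefWithWeight_of_discriminant {α : ℝ} (h1 : -1 < α)
    (h : 8 * (α + 1) * (α + 2) ^ 3 < α ^ 2 * (3 * α + 4) ^ 2) :
    ¬ PosDefWithWeight α (fundMatrix α) := by
  have hα2 : 0 < α + 2 := by linarith
  have hα1 : 0 < α + 1 := by linarith
  refine not_posDefWithWeight_of_lameSymbol_neg (x₀ := EuclideanSpace.single 0 1)
    (ξ := ![1, 1, 0]) (a := !₂[2 * (α + 2) ^ 2, -α * (3 * α + 4), 0]) (by simp) ?_
  have e : lameSymbol α (fundMatrix α) ![1, 1, 0] !₂[2 * (α + 2) ^ 2, -α * (3 * α + 4), 0]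
      (EuclideanSpace.single 0 1)
      = lameConst α * ((α + 2) * (8 * (α + 1) * (α + 2) ^ 3 - α ^ 2 * (3 * α + 4) ^ 2)) := by
    unfold lameSymbol fundMatrix
    simp [Fin.sum_univ_three]
    field_simp
    ring
  rw [e]
  exact mul_neg_of_pos_of_neg (lameConst_pos h1) (mul_neg_of_pos_of_neg hα2 (by linarith))

theorem not_posDefWithWeight_of_qCrit_neg {α : ℝ} (h1 : -1 < α) (h : qCrit α < 0) :
    ¬ PosDefWithWeight α (fundMatrix α) := by
  refine not_posDefWithWeight_of_discriminant h1 ?_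
  unfold qCrit at h
  -- 8(α+1)(α+2)³ − α²(3α+4)² = 4 q(α) − 4α²(α+1).
  nlinarith [mul_nonneg (sq_nonneg α) (by linarith : 0 ≤ α + 1)]

/-! ### Assembly -/

theorem theorem1 :
    ∃ αm αp αcm αcp : ℝ,
      -- the four constants and their approximate values
      (IsLeast {t : ℝ | -1 < t ∧ pMinus t = 0} αm ∧ |αm - (-0.194)| < 0.001) ∧
      (IsGreatest {t : ℝ | -1 < t ∧ pPlus t = 0} αp ∧ |αp - 1.524| < 0.0005) ∧
      (IsLeast {t : ℝ | qCrit t = 0} αcm ∧ |αcm - (-0.902)| < 0.0005) ∧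
      (IsGreatest {t : ℝ | qCrit t = 0} αcp ∧ |αcp - 39.450| < 0.0005) ∧
      -- weighted positive definiteness
      (∀ α : ℝ, αm < α → α < αp → PosDefWithWeight α (fundMatrix α)) ∧
      -- the quantitative lower bound, for fields that need not vanish near the origin
      (∀ α : ℝ, αm < α → α < αp → ∃ c : ℝ, 0 < c ∧
        ∀ u : E3 → E3, ContDiff ℝ ∞ u → HasCompactSupport u →
          Integrable (fun x : E3 => lameIntegrand α (fundMatrix α) u x) ∧
          Integrable (fun x : E3 => gradNormSq u x / ‖x‖) ∧
          1 / 2 * ‖u 0‖ ^ 2 + c * ∫ x : E3, gradNormSq u x / ‖x‖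
            ≤ ∫ x : E3, lameIntegrand α (fundMatrix α) u x) ∧
      -- failure of weighted positive definiteness
      (∀ α : ℝ, -1 < α → (α < αcm ∨ αcp < α) → ¬ PosDefWithWeight α (fundMatrix α)) := by
  obtain ⟨αm, hm, hmL, hm1, hm2⟩ := exists_isLeast_pMinus
  obtain ⟨αp, hp, hpG, hp1, hp2⟩ := exists_isGreatest_pPlus
  obtain ⟨αcm, hcm, hcmL, hcm1, hcm2⟩ := exists_isLeast_qCrit
  obtain ⟨αcp, hcp, hcpG, hcp1, hcp2⟩ := exists_isGreatest_qCrit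
  have hclose : ∀ {z a b c r : ℝ}, z ∈ Set.Icc a b → z ≠ a → z ≠ b → c - r = a → c + r = b →
      |z - c| < r := fun hz ha hb h1 h2 => by
    have h3 := lt_of_le_of_ne hz.1 ha.symm
    have h4 := lt_of_le_of_ne hz.2 hb
    rw [abs_lt]
    constructor <;> linarith
  -- The bound holds on (−0.195, 1.5245), which contains (α₋, α₊) by the location of the zeros.
  have hlower : ∀ α : ℝ, αm < α → α < αp → ∀ u : E3 → E3, ContDiff ℝ ∞ u → HasCompactSupport u →
      1 / 2 * ‖u 0‖ ^ 2 + lameConst α / 10 * ∫ x : E3, gradNormSq u x / ‖x‖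
        ≤ ∫ x : E3, lameIntegrand α (fundMatrix α) u x := fun α h1 h2 u hu hs =>
    lame_weighted_lower_bound (hm.1.trans_lt h1) (h2.trans_le hp.2) hu hs
  have hconst : ∀ α : ℝ, αm < α → 0 < lameConst α / 10 := fun α h1 =>
    div_pos (lameConst_pos (by linarith [hm.1])) (by norm_num)
  refine ⟨αm, αp, αcm, αcp, ⟨hmL, hclose hm hm1 hm2 (by norm_num) (by norm_num)⟩,
    ⟨hpG, hclose hp hp1 hp2 (by norm_num) (by norm_num)⟩,
    ⟨hcmL, hclose hcm hcm1 hcm2 (by norm_num) (by norm_num)⟩,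
    ⟨hcpG, hclose hcp hcp1 hcp2 (by norm_num) (by norm_num)⟩, ?_, ?_, ?_⟩
  · intro α h1 h2 u hu hs _
    refine le_trans ?_ (hlower α h1 h2 u hu hs)
    have : 0 ≤ ∫ x : E3, gradNormSq u x / ‖x‖ := integral_nonneg fun x =>
      div_nonneg (Finset.sum_nonneg fun i _ => Finset.sum_nonneg fun k _ => sq_nonneg _)
        (norm_nonneg x)
    have := mul_nonneg (hconst α h1).le this
    positivity
  · exact fun α h1 h2 => ⟨lameConst α / 10, hconst α h1, fun u hu hs =>
      ⟨integrable_lameIntegrand α hu hs, integrable_gradNormSq_div_norm hu hs,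
        hlower α h1 h2 u hu hs⟩⟩
  · rintro α h1 (h2 | h2)
    · exact not_posDefWithWeight_of_qCrit_neg h1 (qCrit_neg_of_lt_isLeast hcmL h2)
    · exact not_posDefWithWeight_of_qCrit_neg h1 (qCrit_neg_of_isGreatest_lt hcpG h2)
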